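/- Theorem. For an $n$-point metric space $([n],d)$ and $\alpha\ge 1$, call $p\in[n]$ an $\alpha$-approximate 1-median if $\sum_{x\in[n]} d(p,x)\le\alpha\cdot\min_{y\in[n]}\sum_{x\in[n]} d(y,x)$. Consider randomized algorithms on a unit-cost random-access machine with real registers that are given $n$, may query $d(x,y)$ for any $x,y\in[n]$ in one step, and may draw a uniformly random element of $\{0,\dots,m\}$ in one step. There are absolute constants $C,c>0$ such that for every constant $\epsilon>0$ there are such an algorithm (a fixed program, depending only on $\epsilon$) and a threshold $N=N(\epsilon)$ for which the following hold, where $\epsilon_1=\min\{\epsilon,1\}$. (1) For every $n\ge 1$ and every metric $d$ on $[n]$, the algorithm always (that is, for all outcomes of its random draws) halts and outputs a $(2+\epsilon)$-approximate 1-median, and if $n\ge N$ then its expected running time is at most $Cn/\epsilon_1^2$. (2) For every $n\ge N$ and every metric $d$ on $[n]$, with probability at least $c$ the algorithm outputs a $(1+\epsilon)$-approximate 1-median within $Cn/\epsilon_1^2$ steps. In particular, for each constant $\epsilon>0$, metric 1-median has a randomized algorithm that always outputs a $(2+\epsilon)$-approximate solution in expected time $O(n/\epsilon^2)$ and that outputs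 a $(1+\epsilon)$-approximate solution in time $O(n/\epsilon^2)$ with probability $\Omega(1)$. -/

import Mathlib

/-!
Randomized real RAM with a distance oracle, presented as a structured while-language.

The memory consists of arrays of natural numbers and arrays of real numbers (a scalar variable is
one cell of an array).  A program is a finite piece of syntax and mentions only natural-number
constants.  Elementary operations, each of unit cost, are: reading or writing a memory cell
(indirect addressing is allowed), addition and truncated subtraction of natural numbers,
conversion of a natural number to a real one, the four arithmetic operations and comparison of
reals, comparison of natural numbers, one query to the distance oracle, and one draw of a uniformly
random element of `{0, …, m}`.  There is no rounding from reals to natural numbers, and no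
multiplication of natural numbers.
-/

namespace OracleRAM

/-- Memory contents: `nat a i` and `real a i` are the `i`-th cells of the `a`-th arrays. -/
@[ext] structure Store where
  nat : ℕ → ℕ → ℕ
  real : ℕ → ℕ → ℝ

/-- Overwrite cell `i` of the natural-number array `a`. -/
def Store.setNat (s : Store) (a i v : ℕ) : Store :=
  { s with nat := fun b j => if b = a ∧ j = i then v else s.nat b j }

/-- Overwrite cell `i` of the real array `a`. -/
noncomputable def Store.setReal (s : Store) (a i : ℕ) (v : ℝ) : Store :=
  { s with real := fun b j => if b = a ∧ j = i then v else s.real b j }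

/-- Natural-number expressions. -/
inductive NExpr : Type
  | lit (k : ℕ)
  | get (a : ℕ) (i : NExpr)
  | add (e f : NExpr)
  | sub (e f : NExpr)

/-- Value of a natural-number expression (`sub` is truncated subtraction). -/
def NExpr.eval (s : Store) : NExpr → ℕ
  | lit k => k
  | get a i => s.nat a (i.eval s)
  | add e f => e.eval s + f.eval s
  | sub e f => e.eval s - f.eval s

/-- Number of elementary operations needed to evaluate a natural-number expression. -/
def NExpr.cost : NExpr → ℕ
  | lit _ => 1
  | get _ i => i.cost + 1
  | add e f => e.cost + f.cost + 1
  | sub e f => e.cost + f.cost + 1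

/-- Real expressions; `query e f` asks the oracle for the distance between points `e` and `f`. -/
inductive RExpr : Type
  | ofNat (e : NExpr)
  | get (a : ℕ) (i : NExpr)
  | query (e f : NExpr)
  | add (x y : RExpr)
  | sub (x y : RExpr)
  | mul (x y : RExpr)
  | div (x y : RExpr)

/-- Value of a real expression with oracle `d` (a division by zero returns zero). -/
noncomputable def RExpr.eval (d : ℕ → ℕ → ℝ) (s : Store) : RExpr → ℝ
  | ofNat e => (e.eval s : ℝ)
  | get a i => s.real a (i.eval s)
  | query e f => d (e.eval s) (f.eval s)
  | add x y => x.eval d s + y.eval d s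
  | sub x y => x.eval d s - y.eval d s
  | mul x y => x.eval d s * y.eval d s
  | div x y => x.eval d s / y.eval d s

/-- Number of elementary operations needed to evaluate a real expression. -/
def RExpr.cost : RExpr → ℕ
  | ofNat e => e.cost + 1
  | get _ i => i.cost + 1
  | query e f => e.cost + f.cost + 1
  | add x y => x.cost + y.cost + 1
  | sub x y => x.cost + y.cost + 1
  | mul x y => x.cost + y.cost + 1
  | div x y => x.cost + y.cost + 1

/-- Tests. -/
inductive BExpr : Type
  | natLT (e f : NExpr)
  | realLT (x y : RExpr)
  | not (b : BExpr)
  | and (b c : BExpr)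

/-- Truth of a test. -/
def BExpr.Holds (d : ℕ → ℕ → ℝ) (s : Store) : BExpr → Prop
  | natLT e f => e.eval s < f.eval s
  | realLT x y => x.eval d s < y.eval d s
  | not b => ¬ b.Holds d s
  | and b c => b.Holds d s ∧ c.Holds d s

/-- Number of elementary operations needed to evaluate a test. -/
def BExpr.cost : BExpr → ℕ
  | natLT e f => e.cost + f.cost + 1
  | realLT x y => x.cost + y.cost + 1
  | not b => b.cost + 1
  | and b c => b.cost + c.cost + 1

/-- Programs.  `setNat a i e` and `setReal a i e` write the value of `e` into cell `i` of array `a`,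
and `rand a i e` writes a uniformly random element of `{0, …, value of e}` there. -/
inductive Prog : Type
  | skip
  | setNat (a : ℕ) (i e : NExpr)
  | setReal (a : ℕ) (i : NExpr) (e : RExpr)
  | rand (a : ℕ) (i e : NExpr)
  | seq (p q : Prog)
  | ite (b : BExpr) (p q : Prog)
  | loop (b : BExpr) (p : Prog)

/-- Joint law of the final memory and the running time after `t` further steps are charged. -/
noncomputable def charge (t : ℕ) (μ : PMF (Store × ℕ)) : PMF (Store × ℕ) :=
  μ.map fun y => (y.1, t + y.2)

/-- Run a computation with law `μ`, then continue from its final memory according to `κ`;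
running times add up. -/
noncomputable def andThen (μ : PMF (Store × ℕ)) (κ : Store → PMF (Store × ℕ)) :
    PMF (Store × ℕ) :=
  μ.bind fun x => charge x.2 (κ x.1)

/-- `Runs d p s μ`: with oracle `d` and initial memory `s`, the program `p` halts whatever the
outcomes of its random draws are, and `μ` is the joint law of (final memory, number of steps).
The draws are independent and uniform.  A program that may fail to halt satisfies no `Runs`. -/
inductive Runs (d : ℕ → ℕ → ℝ) : Prog → Store → PMF (Store × ℕ) → Prop
  | skip (s : Store) : Runs d .skip s (PMF.pure (s, 1))
  | setNat (a : ℕ) (i e : NExpr) (s : Store) :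
      Runs d (.setNat a i e) s
        (PMF.pure (s.setNat a (i.eval s) (e.eval s), i.cost + e.cost + 1))
  | setReal (a : ℕ) (i : NExpr) (e : RExpr) (s : Store) :
      Runs d (.setReal a i e) s
        (PMF.pure (s.setReal a (i.eval s) (e.eval d s), i.cost + e.cost + 1))
  | rand (a : ℕ) (i e : NExpr) (s : Store) :
      Runs d (.rand a i e) s
        ((PMF.uniformOfFinset (Finset.range (e.eval s + 1)) Finset.nonempty_range_add_one).map
          fun v => (s.setNat a (i.eval s) v, i.cost + e.cost + 1))
  | seq (p q : Prog) (s : Store) (μ : PMF (Store × ℕ)) (κ : Store → PMF (Store × ℕ)) :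
      Runs d p s μ → (∀ x ∈ μ.support, Runs d q x.1 (κ x.1)) →
      Runs d (.seq p q) s (andThen μ κ)
  | ite_true (b : BExpr) (p q : Prog) (s : Store) (μ : PMF (Store × ℕ)) :
      b.Holds d s → Runs d p s μ → Runs d (.ite b p q) s (charge (b.cost + 1) μ)
  | ite_false (b : BExpr) (p q : Prog) (s : Store) (μ : PMF (Store × ℕ)) :
      ¬ b.Holds d s → Runs d q s μ → Runs d (.ite b p q) s (charge (b.cost + 1) μ)
  | loop_false (b : BExpr) (p : Prog) (s : Store) :
      ¬ b.Holds d s → Runs d (.loop b p) s (PMF.pure (s, b.cost + 1))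
  | loop_true (b : BExpr) (p : Prog) (s : Store) (μ : PMF (Store × ℕ))
      (κ : Store → PMF (Store × ℕ)) :
      b.Holds d s → Runs d p s μ → (∀ x ∈ μ.support, Runs d (.loop b p) x.1 (κ x.1)) →
      Runs d (.loop b p) s (charge (b.cost + 1) (andThen μ κ))

/-- Initial memory on input `n`: cell 0 of the natural-number array 0 holds `n`, the rest is 0. -/
def initial (n : ℕ) : Store where
  nat := fun a i => if a = 0 ∧ i = 0 then n else 0
  real := fun _ _ => 0

/-- The output of a halted program is what it left in cell 0 of the natural-number array 1. -/
def output (s : Store) : ℕ := s.nat 1 0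

end OracleRAM

/-- The oracle of a metric on `{0, …, n - 1}`; queries outside the space are answered by 0. -/
noncomputable def distOracle {n : ℕ} (M : MetricSpace (Fin n)) (i j : ℕ) : ℝ :=
  if h : i < n ∧ j < n then M.dist ⟨i, h.1⟩ ⟨j, h.2⟩ else 0

/-- `p` is an `α`-approximate 1-median of the metric space `M` on `{0, …, n - 1}`. -/
def IsApproxMedian {n : ℕ} (M : MetricSpace (Fin n)) (α : ℝ) (p : ℕ) : Prop :=
  ∃ hp : p < n, ∑ x, M.dist ⟨p, hp⟩ x ≤ α * ⨅ y : Fin n, ∑ x, M.dist y x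

/-- Expected running time under a joint law of (final memory, running time). -/
noncomputable def expectedTime (μ : PMF (OracleRAM.Store × ℕ)) : ENNReal :=
  ∑' x, μ x * (x.2 : ENNReal)

/-!
Sums of distances along a cyclic shift `x ↦ x + r (mod n)` give a cheap certificate.  By the triangle
inequality through the optimal point, each shift sum is at most twice the optimum `o`, so a point
whose cost is at most `1 + 1 / K` times some shift sum is a `2 + 2 / K`-approximate median, with
certainty.  Averaged over `r`, the shift sums equal the average cost of a point, which is at least `o`
(`sum_shiftSum`).  Hence a fraction of order `1 / K` of the shifts have a sum of nearly `o` or more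
(`sum_shiftSum_small_le`), and among `O(K)` random shifts, which take time `O(n K)`, there is one with
probability at least `3 / 4` (`wp_shiftLoop`).  It certifies any point of cost at most
`(1 + 1 / (4 K)) o`.

Such a point is found by a knockout tournament.  Two points `a`, `b` are compared by summing
`d(a, u) - d(b, u)` over random `u`.  This quantity is bounded by `d(a, b)`, which is at most the sum
of the two costs divided by `n`, and its mean is their difference divided by `n`.  So if one cost is `o` or slightly more and the other one
exceeds it by `e * o`, then, by Chebyshev's inequality `k` samples decide wrongly with probability
`O(1 / (k e ^ 2))` (`wp_duel`).  In each round of the tournament only the duel of one cheap candidate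
matters (`wp_sweepLoop`), so no union bound over the points is needed.  From round to round the number
of candidates is halved, `k` grows by the factor `3 / 2`, and `e` shrinks by the factor `7 / 8`.  As
`3 / 2 < 2`, the total time is dominated by the first round, hence `O(n K ^ 2)`; as
`3 / 2 * (7 / 8) ^ 2 > 1`, the failure probabilities form a convergent geometric series
(`wp_tourLoop`).

The algorithm repeats tournament and shifts until there is a certificate.  Every repetition succeeds
with probability at least `1 / 2` (`wp_round`), which gives the expected time and the probability of
success in the first attempt.  To make it halt for all random outcomes, the `t`-th repetition also
computes the cost of the point `t`, so that after `n` repetitions the best point known is optimal.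

The programs are verified in a Hoare logic with expected losses (`WP`).  Chebyshev's inequality and the
geometric decay of failure probabilities appear there as losses that do not increase in expectation
along a loop, so that no joint law of several random draws is ever needed.  As a run determines its
law (`Runs.unique`), the expected time and the success probability can be bounded separately.

Memory layout (scalars are in cell 0 of an array).  Natural numbers: 0 the size `n`, 1 the best
point, 2 the number of repetitions, 3 and 4 loop counters, 5 the last random draw, 6 the array of
candidates, 7 the number of candidates, 8 the slot of the current duel.  Reals: 0 an accumulator, 1 the
cost of the best point, 2 the largest shift sum, 3 the number of samples per duel.
-/

open scoped ENNReal

namespace OracleRAM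

variable {d : ℕ → ℕ → ℝ}

/-! ### Runs are deterministic -/

theorem andThen_congr {μ : PMF (Store × ℕ)} {κ κ' : Store → PMF (Store × ℕ)}
    (h : ∀ x ∈ μ.support, κ x.1 = κ' x.1) : andThen μ κ = andThen μ κ' := by
  unfold andThen
  ext y
  simp only [PMF.bind_apply]
  refine tsum_congr fun x => ?_
  by_cases hx : x ∈ μ.support
  · rw [h x hx]
  · rw [PMF.mem_support_iff, not_not] at hx
    simp [hx]

theorem Runs.unique {p : Prog} {s : Store} {μ ν : PMF (Store × ℕ)}
    (h : Runs d p s μ) (h' : Runs d p s ν) : μ = ν := by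
  induction h generalizing ν with
  | skip s => cases h'; rfl
  | setNat a i e s => cases h'; rfl
  | setReal a i e s => cases h'; rfl
  | rand a i e s => cases h'; rfl
  | seq p q s μ κ _ _ ihp ihq =>
    cases h' with
    | seq _ _ _ μ' κ' hp' hq' =>
      obtain rfl := ihp hp'
      exact andThen_congr fun x hx => ihq x hx (hq' x hx)
  | ite_true b p q s μ hb _ ih =>
    cases h' with
    | ite_true _ _ _ _ μ' _ hp' => rw [ih hp']
    | ite_false _ _ _ _ μ' hb' _ => exact absurd hb hb'
  | ite_false b p q s μ hb _ ih =>
    cases h' with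
    | ite_true _ _ _ _ μ' hb' _ => exact absurd hb' hb
    | ite_false _ _ _ _ μ' _ hp' => rw [ih hp']
  | loop_false b p s hb =>
    cases h' with
    | loop_false => rfl
    | loop_true _ _ _ _ _ hb' => exact absurd hb' hb
  | loop_true b p s μ κ hb _ _ ihp ihq =>
    cases h' with
    | loop_false _ _ _ hb' => exact absurd hb hb'
    | loop_true _ _ _ μ' κ' _ hp' hq' =>
      obtain rfl := ihp hp'
      rw [andThen_congr fun x hx => ihq x hx (hq' x hx)]

/-! ### Memory that a program leaves alone -/

/-- Whether the text of a program contains a write to the natural-number array `a`. -/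
def Prog.setsNat (a : ℕ) : Prog → Bool
  | skip => false
  | setNat b _ _ => b == a
  | setReal _ _ _ => false
  | rand b _ _ => b == a
  | seq p q => p.setsNat a || q.setsNat a
  | ite _ p q => p.setsNat a || q.setsNat a
  | loop _ p => p.setsNat a

/-- Whether the text of a program contains a write to the real array `a`. -/
def Prog.setsReal (a : ℕ) : Prog → Bool
  | skip => false
  | setNat _ _ _ => false
  | setReal b _ _ => b == a
  | rand _ _ _ => false
  | seq p q => p.setsReal a || q.setsReal a
  | ite _ p q => p.setsReal a || q.setsReal a
  | loop _ p => p.setsReal a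

/-- `s'` agrees with `s` on all arrays that `p` never writes to. -/
structure Unchanged (p : Prog) (s s' : Store) : Prop where
  nat : ∀ a, p.setsNat a = false → s'.nat a = s.nat a
  real : ∀ a, p.setsReal a = false → s'.real a = s.real a

theorem Unchanged.refl (p : Prog) (s : Store) : Unchanged p s s := ⟨fun _ _ => rfl, fun _ _ => rfl⟩

theorem Unchanged.trans {p : Prog} {s s' s'' : Store} (h : Unchanged p s s')
    (h' : Unchanged p s' s'') : Unchanged p s s'' :=
  ⟨fun a ha => (h'.nat a ha).trans (h.nat a ha), fun a ha => (h'.real a ha).trans (h.real a ha)⟩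

theorem Unchanged.of_imp {p q : Prog} {s s' : Store} (h : Unchanged p s s')
    (hn : ∀ a, q.setsNat a = false → p.setsNat a = false)
    (hr : ∀ a, q.setsReal a = false → p.setsReal a = false) : Unchanged q s s' :=
  ⟨fun a ha => h.nat a (hn a ha), fun a ha => h.real a (hr a ha)⟩

theorem mem_support_charge {t : ℕ} {μ : PMF (Store × ℕ)} {x : Store × ℕ}
    (h : x ∈ (charge t μ).support) : ∃ y ∈ μ.support, x = (y.1, t + y.2) := by
  unfold charge at h
  rw [PMF.mem_support_map_iff] at h
  obtain ⟨y, hy, rfl⟩ := h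
  exact ⟨y, hy, rfl⟩

theorem mem_support_andThen {μ : PMF (Store × ℕ)} {κ : Store → PMF (Store × ℕ)} {x : Store × ℕ}
    (h : x ∈ (andThen μ κ).support) :
    ∃ y ∈ μ.support, ∃ z ∈ (κ y.1).support, x = (z.1, y.2 + z.2) := by
  unfold andThen at h
  rw [PMF.mem_support_bind_iff] at h
  obtain ⟨y, hy, hx⟩ := h
  exact ⟨y, hy, mem_support_charge hx⟩

theorem Runs.unchanged {p : Prog} {s : Store} {μ : PMF (Store × ℕ)} (h : Runs d p s μ) :
    ∀ x ∈ μ.support, Unchanged p s x.1 := by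
  induction h with
  | skip s =>
    intro x hx
    rw [PMF.support_pure, Set.mem_singleton_iff] at hx
    subst hx
    exact .refl _ _
  | setNat a i e s =>
    intro x hx
    rw [PMF.support_pure, Set.mem_singleton_iff] at hx
    subst hx
    refine ⟨fun b hb => ?_, fun _ _ => rfl⟩
    have : b ≠ a := fun h => by simp [Prog.setsNat, h] at hb
    funext j
    simp [Store.setNat, this]
  | setReal a i e s =>
    intro x hx
    rw [PMF.support_pure, Set.mem_singleton_iff] at hx
    subst hx
    refine ⟨fun _ _ => rfl, fun b hb => ?_⟩
    have : b ≠ a := fun h => by simp [Prog.setsReal, h] at hb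
    funext j
    simp [Store.setReal, this]
  | rand a i e s =>
    intro x hx
    rw [PMF.mem_support_map_iff] at hx
    obtain ⟨v, -, rfl⟩ := hx
    refine ⟨fun b hb => ?_, fun _ _ => rfl⟩
    have : b ≠ a := fun h => by simp [Prog.setsNat, h] at hb
    funext j
    simp [Store.setNat, this]
  | seq p q s μ κ _ _ ihp ihq =>
    intro x hx
    obtain ⟨y, hy, z, hz, rfl⟩ := mem_support_andThen hx
    refine ((ihp y hy).of_imp ?_ ?_).trans ((ihq y hy z hz).of_imp ?_ ?_) <;>
      simp +contextual [Prog.setsNat, Prog.setsReal]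
  | ite_true b p q s μ _ _ ih =>
    intro x hx
    obtain ⟨y, hy, rfl⟩ := mem_support_charge hx
    refine (ih y hy).of_imp ?_ ?_ <;> simp +contextual [Prog.setsNat, Prog.setsReal]
  | ite_false b p q s μ _ _ ih =>
    intro x hx
    obtain ⟨y, hy, rfl⟩ := mem_support_charge hx
    refine (ih y hy).of_imp ?_ ?_ <;> simp +contextual [Prog.setsNat, Prog.setsReal]
  | loop_false b p s _ =>
    intro x hx
    rw [PMF.support_pure, Set.mem_singleton_iff] at hx
    subst hx
    exact .refl _ _
  | loop_true b p s μ κ _ _ _ ihp ihq =>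
    intro x hx
    obtain ⟨w, hw, rfl⟩ := mem_support_charge hx
    obtain ⟨y, hy, z, hz, rfl⟩ := mem_support_andThen hw
    exact ((ihp y hy).of_imp (q := .loop b p) (fun _ h => h) (fun _ h => h)).trans (ihq y hy z hz)

/-! ### A quantitative Hoare logic -/

theorem tsum_pure_mul {α : Type*} (a : α) (f : α → ℝ≥0∞) :
    ∑' x, (PMF.pure a) x * f x = f a := by
  rw [tsum_eq_single a]
  · simp [PMF.pure_apply]
  · intro b hb
    simp [PMF.pure_apply, hb]

theorem tsum_bind_mul {α β : Type*} (μ : PMF α) (κ : α → PMF β) (f : β → ℝ≥0∞) :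
    ∑' y, (μ.bind κ) y * f y = ∑' x, μ x * ∑' y, κ x y * f y := by
  simp only [PMF.bind_apply, ← ENNReal.tsum_mul_right, ← ENNReal.tsum_mul_left, mul_assoc]
  exact ENNReal.tsum_comm

theorem tsum_map_mul {α β : Type*} (μ : PMF α) (g : α → β) (f : β → ℝ≥0∞) :
    ∑' y, (μ.map g) y * f y = ∑' x, μ x * f (g x) := by
  unfold PMF.map
  rw [tsum_bind_mul]
  simp only [Function.comp_apply, tsum_pure_mul]

theorem tsum_mul_le {α : Type*} (μ : PMF α) {f : α → ℝ≥0∞} {c : ℝ≥0∞}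
    (h : ∀ x ∈ μ.support, f x ≤ c) : ∑' x, μ x * f x ≤ c := by
  calc ∑' x, μ x * f x ≤ ∑' x, μ x * c := by
        refine ENNReal.tsum_le_tsum fun x => ?_
        by_cases hx : x ∈ μ.support
        · gcongr
          exact h x hx
        · rw [PMF.mem_support_iff, not_not] at hx
          simp [hx]
    _ = c := by rw [ENNReal.tsum_mul_right, μ.tsum_coe, one_mul]

/-- Total correctness with an expected loss: started in `s` after `t` elapsed steps, `p` halts for
all random outcomes, every possible final memory `x` and total elapsed time `t'` satisfy `A x t'`,
and the expectation of `f x t'` is at most `b`. -/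
def WP (d : ℕ → ℕ → ℝ) (p : Prog) (s : Store) (t : ℕ) (A : Store → ℕ → Prop)
    (f : Store → ℕ → ℝ≥0∞) (b : ℝ≥0∞) : Prop :=
  ∃ μ, Runs d p s μ ∧ (∀ x ∈ μ.support, A x.1 (t + x.2)) ∧ ∑' x, μ x * f x.1 (t + x.2) ≤ b

namespace WP

variable {p q : Prog} {s : Store} {t : ℕ} {A A' : Store → ℕ → Prop} {f f' g : Store → ℕ → ℝ≥0∞}
  {b b' c : ℝ≥0∞}

theorem mono (h : WP d p s t A f b) (hA : ∀ x t', A x t' → A' x t')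
    (hf : ∀ x t', A x t' → f' x t' ≤ f x t') (hb : b ≤ b') : WP d p s t A' f' b' := by
  obtain ⟨μ, hμ, hs, he⟩ := h
  refine ⟨μ, hμ, fun x hx => hA _ _ (hs x hx), le_trans ?_ (he.trans hb)⟩
  refine ENNReal.tsum_le_tsum fun x => ?_
  by_cases hx : x ∈ μ.support
  · gcongr
    exact hf _ _ (hs x hx)
  · rw [PMF.mem_support_iff, not_not] at hx
    simp [hx]

theorem const (h : WP d p s t A f b) (hA : ∀ x t', A x t' → A' x t' ∧ f' x t' ≤ c) :
    WP d p s t A' f' c := by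
  obtain ⟨μ, hμ, hs, -⟩ := h
  exact ⟨μ, hμ, fun x hx => (hA _ _ (hs x hx)).1, tsum_mul_le μ fun x hx => (hA _ _ (hs x hx)).2⟩

theorem add_const (h : WP d p s t A f b) (c : ℝ≥0∞) :
    WP d p s t A (fun x t' => f x t' + c) (b + c) := by
  obtain ⟨μ, hμ, hs, he⟩ := h
  refine ⟨μ, hμ, hs, ?_⟩
  simp only [mul_add]
  rw [ENNReal.tsum_add, ENNReal.tsum_mul_right, μ.tsum_coe, one_mul]
  gcongr

theorem const_mul (h : WP d p s t A f b) (c : ℝ≥0∞) :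
    WP d p s t A (fun x t' => c * f x t') (c * b) := by
  obtain ⟨μ, hμ, hs, he⟩ := h
  refine ⟨μ, hμ, hs, ?_⟩
  simp only [mul_left_comm _ c]
  rw [ENNReal.tsum_mul_left]
  gcongr

theorem unchanged (h : WP d p s t A f b) :
    WP d p s t (fun x t' => A x t' ∧ Unchanged p s x) f b := by
  obtain ⟨μ, hμ, hs, he⟩ := h
  exact ⟨μ, hμ, fun x hx => ⟨hs x hx, hμ.unchanged x hx⟩, he⟩

theorem skip (hA : A s (t + 1)) (hf : f s (t + 1) ≤ b) : WP d .skip s t A f b := by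
  refine ⟨_, .skip s, ?_, ?_⟩
  · simpa [PMF.support_pure] using hA
  · rw [tsum_pure_mul]; exact hf

theorem setNat {a : ℕ} {i e : NExpr}
    (hA : A (s.setNat a (i.eval s) (e.eval s)) (t + (i.cost + e.cost + 1)))
    (hf : f (s.setNat a (i.eval s) (e.eval s)) (t + (i.cost + e.cost + 1)) ≤ b) :
    WP d (.setNat a i e) s t A f b := by
  refine ⟨_, .setNat a i e s, ?_, ?_⟩
  · simpa [PMF.support_pure] using hA
  · rw [tsum_pure_mul]; exact hf

theorem setReal {a : ℕ} {i : NExpr} {e : RExpr}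
    (hA : A (s.setReal a (i.eval s) (e.eval d s)) (t + (i.cost + e.cost + 1)))
    (hf : f (s.setReal a (i.eval s) (e.eval d s)) (t + (i.cost + e.cost + 1)) ≤ b) :
    WP d (.setReal a i e) s t A f b := by
  refine ⟨_, .setReal a i e s, ?_, ?_⟩
  · simpa [PMF.support_pure] using hA
  · rw [tsum_pure_mul]; exact hf

theorem rand {a : ℕ} {i e : NExpr}
    (hA : ∀ v ≤ e.eval s, A (s.setNat a (i.eval s) v) (t + (i.cost + e.cost + 1)))
    (hf : (∑ v ∈ Finset.range (e.eval s + 1),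
      f (s.setNat a (i.eval s) v) (t + (i.cost + e.cost + 1))) / (e.eval s + 1 : ℕ) ≤ b) :
    WP d (.rand a i e) s t A f b := by
  refine ⟨_, .rand a i e s, ?_, ?_⟩
  · intro x hx
    rw [PMF.mem_support_map_iff] at hx
    obtain ⟨v, hv, rfl⟩ := hx
    rw [PMF.mem_support_uniformOfFinset_iff, Finset.mem_range] at hv
    exact hA v (by omega)
  · rw [tsum_map_mul]
    refine le_trans (le_of_eq ?_) hf
    rw [tsum_eq_sum (s := Finset.range (e.eval s + 1))]
    · rw [div_eq_mul_inv, Finset.sum_mul]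
      refine Finset.sum_congr rfl fun v hv => ?_
      rw [PMF.uniformOfFinset_apply, if_pos hv, Finset.card_range, mul_comm]
    · intro v hv
      rw [PMF.uniformOfFinset_apply, if_neg hv, zero_mul]

theorem seq (h : WP d p s t (fun x t' => WP d q x t' A f (g x t')) g b) :
    WP d (.seq p q) s t A f b := by
  classical
  obtain ⟨μ, hμ, hs, he⟩ := h
  -- the continuation must depend on the memory only, not on the elapsed time
  let κ : Store → PMF (Store × ℕ) := fun x =>
    if h : ∃ ν, Runs d q x ν then h.choose else PMF.pure (x, 0)
  have hκ : ∀ x ν, Runs d q x ν → κ x = ν := fun x ν h => by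
    have hex : ∃ ν, Runs d q x ν := ⟨ν, h⟩
    simp only [κ, dif_pos hex]
    exact hex.choose_spec.unique h
  have key : ∀ x ∈ μ.support, Runs d q x.1 (κ x.1) ∧
      (∀ y ∈ (κ x.1).support, A y.1 (t + x.2 + y.2)) ∧
      ∑' y, κ x.1 y * f y.1 (t + x.2 + y.2) ≤ g x.1 (t + x.2) := by
    intro x hx
    obtain ⟨ν, hν, h1, h2⟩ := hs x hx
    rw [hκ _ _ hν]
    exact ⟨hν, h1, h2⟩
  refine ⟨_, .seq p q s μ κ hμ fun x hx => (key x hx).1, ?_, ?_⟩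
  · intro x hx
    obtain ⟨y, hy, z, hz, rfl⟩ := mem_support_andThen hx
    rw [← add_assoc]
    exact (key y hy).2.1 z hz
  · refine le_trans ?_ he
    unfold andThen
    rw [tsum_bind_mul]
    refine ENNReal.tsum_le_tsum fun x => ?_
    by_cases hx : x ∈ μ.support
    · gcongr
      unfold charge
      rw [tsum_map_mul]
      simp only [← add_assoc]
      exact (key x hx).2.2
    · rw [PMF.mem_support_iff, not_not] at hx
      simp [hx]

/-- Sequencing in the case where the first program matters only through what holds for all its outcomes. -/
theorem seq_const (h : WP d p s t A' f' b') (h' : ∀ x t', A' x t' → WP d q x t' A f b) :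
    WP d (.seq p q) s t A f b :=
  seq (g := fun _ _ => b) (h.const fun _ _ hx => ⟨h' _ _ hx, le_rfl⟩)

theorem seq_setNat {a : ℕ} {i e : NExpr}
    (h : WP d q (s.setNat a (i.eval s) (e.eval s)) (t + (i.cost + e.cost + 1)) A f b) :
    WP d (.seq (.setNat a i e) q) s t A f b :=
  seq (g := fun _ _ => b) (setNat h le_rfl)

theorem seq_setReal {a : ℕ} {i : NExpr} {e : RExpr}
    (h : WP d q (s.setReal a (i.eval s) (e.eval d s)) (t + (i.cost + e.cost + 1)) A f b) :
    WP d (.seq (.setReal a i e) q) s t A f b :=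
  seq (g := fun _ _ => b) (setReal h le_rfl)

theorem charge {c : ℕ} {μ : PMF (Store × ℕ)} (hA : ∀ x ∈ μ.support, A x.1 (t + c + x.2))
    (hf : ∑' x, μ x * f x.1 (t + c + x.2) ≤ b) :
    (∀ x ∈ (OracleRAM.charge c μ).support, A x.1 (t + x.2)) ∧
      ∑' x, (OracleRAM.charge c μ) x * f x.1 (t + x.2) ≤ b := by
  constructor
  · intro x hx
    obtain ⟨y, hy, rfl⟩ := mem_support_charge hx
    rw [← add_assoc]
    exact hA y hy
  · unfold OracleRAM.charge
    rw [tsum_map_mul]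
    simp only [← add_assoc]
    exact hf

theorem ite {e : BExpr} (h1 : e.Holds d s → WP d p s (t + (e.cost + 1)) A f b)
    (h2 : ¬ e.Holds d s → WP d q s (t + (e.cost + 1)) A f b) : WP d (.ite e p q) s t A f b := by
  by_cases he : e.Holds d s
  · obtain ⟨μ, hμ, hA, hf⟩ := h1 he
    exact ⟨_, .ite_true e p q s μ he hμ, charge hA hf⟩
  · obtain ⟨μ, hμ, hA, hf⟩ := h2 he
    exact ⟨_, .ite_false e p q s μ he hμ, charge hA hf⟩

theorem loop_exit {e : BExpr} (he : ¬ e.Holds d s) (hA : A s (t + (e.cost + 1)))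
    (hf : f s (t + (e.cost + 1)) ≤ b) : WP d (.loop e p) s t A f b := by
  refine ⟨_, .loop_false e p s he, ?_, ?_⟩
  · simpa [PMF.support_pure] using hA
  · rw [tsum_pure_mul]; exact hf

theorem loop_step {e : BExpr} (he : e.Holds d s)
    (h : WP d p s (t + (e.cost + 1)) (fun x t' => WP d (.loop e p) x t' A f (g x t')) g b) :
    WP d (.loop e p) s t A f b := by
  obtain ⟨μ, hμ, hA, hf⟩ := seq h
  cases hμ with
  | seq _ _ _ μ κ hp hq => exact ⟨_, .loop_true e p s μ κ he hp hq, charge hA hf⟩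

theorem loop_step_const {e : BExpr} (he : e.Holds d s)
    (h : WP d p s (t + (e.cost + 1)) (fun x t' => WP d (.loop e p) x t' A f b) 0 0) :
    WP d (.loop e p) s t A f b :=
  loop_step (g := fun _ _ => b) he (h.const fun _ _ hx => ⟨hx, le_rfl⟩)

end WP

/-! ### Summation programs -/

/-- The scalar variable kept in cell 0 of the natural-number array `a`. -/
abbrev NExpr.var (a : ℕ) : NExpr := .get a (.lit 0)

/-- The scalar variable kept in cell 0 of the real array `a`. -/
abbrev RExpr.var (a : ℕ) : RExpr := .get a (.lit 0)

theorem Unchanged.setNat {p : Prog} {s s' : Store} (h : Unchanged p s s') {a : ℕ}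
    (ha : p.setsNat a = true) (i v : ℕ) : Unchanged p s (s'.setNat a i v) := by
  refine ⟨fun b hb => ?_, h.real⟩
  have : b ≠ a := fun e => by simp [e, ha] at hb
  rw [← h.nat b hb]
  funext j
  simp [Store.setNat, this]

theorem Unchanged.setReal {p : Prog} {s s' : Store} (h : Unchanged p s s') {a : ℕ}
    (ha : p.setsReal a = true) (i : ℕ) (v : ℝ) : Unchanged p s (s'.setReal a i v) := by
  refine ⟨h.nat, fun b hb => ?_⟩
  have : b ≠ a := fun e => by simp [e, ha] at hb
  rw [← h.real b hb]
  funext j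
  simp [Store.setReal, this]

/-- `acc := acc + d(e, f)`, where `acc` is real variable 0. -/
def accumulate (e f : NExpr) : Prog := .setReal 0 (.lit 0) (.add (.var 0) (.query e f))

/-- The loop of `sumLoop`: run `body` for all remaining values of variable 3 below `n`, which is kept
in variable 0. -/
def sumLoopCore (body : Prog) : Prog :=
  .loop (.natLT (.var 3) (.var 0)) (.seq body (.setNat 3 (.lit 0) (.add (.var 3) (.lit 1))))

/-- Reset real variable 0 and run `body` for each value `x < n` of variable 3. -/
def sumLoop (body : Prog) : Prog :=
  .seq (.setNat 3 (.lit 0) (.lit 0)) (.seq (.setReal 0 (.lit 0) (.ofNat (.lit 0)))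
    (sumLoopCore body))

theorem wp_sumLoopCore {body : Prog} {s₀ : Store} {n B : ℕ} {g : ℕ → ℝ}
    (h0 : body.setsNat 0 = false) (hn : s₀.nat 0 0 = n)
    (hbody : ∀ s t, Unchanged (sumLoop body) s₀ s → s.nat 3 0 < n →
      WP d body s t (fun x t' => x = s.setReal 0 0 (s.real 0 0 + g (s.nat 3 0)) ∧ t' ≤ t + B) 0 0)
    (k : ℕ) (s : Store) (t : ℕ) (hs : Unchanged (sumLoop body) s₀ s) (hk : s.nat 3 0 + k = n)
    (hacc : s.real 0 0 = ∑ i ∈ Finset.range (s.nat 3 0), g i) :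
    WP d (sumLoopCore body) s t (fun x t' => x.real 0 0 = ∑ i ∈ Finset.range n, g i ∧
      t' ≤ t + (B + 12) * k + 6) 0 0 := by
  induction k generalizing s t with
  | zero =>
    have hn' : s.nat 0 0 = n := by
      rw [hs.nat 0 (by simp [sumLoop, sumLoopCore, Prog.setsNat, h0]), hn]
    refine WP.loop_exit ?_ ⟨?_, ?_⟩ (by simp)
    · simp only [BExpr.Holds, NExpr.eval, hn']
      omega
    · rw [hacc, ← hk, add_zero]
    · simp [BExpr.cost, NExpr.cost]
  | succ k ih =>
    have hn' : s.nat 0 0 = n := by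
      rw [hs.nat 0 (by simp [sumLoop, sumLoopCore, Prog.setsNat, h0]), hn]
    have hlt : BExpr.Holds d s (.natLT (.var 3) (.var 0)) := by
      simp only [BExpr.Holds, NExpr.eval, hn']
      omega
    refine WP.loop_step_const hlt (WP.seq_const (hbody s _ hs (by omega)) ?_)
    rintro x t' ⟨rfl, ht'⟩
    refine WP.setNat ?_ (by simp)
    refine (ih _ _ ?_ ?_ ?_).mono ?_ (by simp) le_rfl
    · exact (hs.setReal (by simp [sumLoop, Prog.setsReal]) _ _).setNat
        (by simp [sumLoop, Prog.setsNat]) _ _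
    · simp [Store.setNat, Store.setReal, NExpr.eval]
      omega
    · simp [Store.setNat, Store.setReal, NExpr.eval, Finset.sum_range_succ, hacc]
    · rintro x t'' ⟨h1, h2⟩
      refine ⟨h1, h2.trans ?_⟩
      simp only [BExpr.cost, NExpr.cost] at ht' ⊢
      nlinarith

theorem wp_sumLoop {body : Prog} {s : Store} {n B : ℕ} {g : ℕ → ℝ}
    (h0 : body.setsNat 0 = false) (hn : s.nat 0 0 = n)
    (hbody : ∀ s' t, Unchanged (sumLoop body) s s' → s'.nat 3 0 < n →
      WP d body s' t (fun x t' => x = s'.setReal 0 0 (s'.real 0 0 + g (s'.nat 3 0)) ∧ t' ≤ t + B)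
        0 0) (t : ℕ) :
    WP d (sumLoop body) s t (fun x t' => (x.real 0 0 = ∑ i ∈ Finset.range n, g i ∧
      t' ≤ t + (B + 12) * n + 13) ∧ Unchanged (sumLoop body) s x) 0 0 := by
  apply WP.unchanged
  refine WP.seq_setNat (WP.seq_setReal ((wp_sumLoopCore h0 hn hbody n _ _ ?_ ?_ ?_).mono ?_
    (by simp) le_rfl))
  · exact ((Unchanged.refl _ _).setNat (by simp [sumLoop, Prog.setsNat]) _ _).setReal
      (by simp [sumLoop, Prog.setsReal]) _ _
  · simp [Store.setNat, Store.setReal, NExpr.eval]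
  · simp [Store.setNat, Store.setReal, NExpr.eval, RExpr.eval]
  · rintro x t' ⟨h1, h2⟩
    refine ⟨h1, h2.trans ?_⟩
    simp [NExpr.cost, RExpr.cost]
    omega

theorem wp_accumulate {e f : NExpr} {s : Store} {t : ℕ} :
    WP d (accumulate e f) s t (fun x t' =>
      x = s.setReal 0 0 (s.real 0 0 + d (e.eval s) (f.eval s)) ∧ t' ≤ t + (e.cost + f.cost + 6))
      0 0 := by
  refine WP.setReal ⟨?_, ?_⟩ (by simp)
  · simp [NExpr.eval, RExpr.eval]
  · simp [NExpr.cost, RExpr.cost]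
    omega

/-- The sum of the distances from the point `i` to the points of `{0, …, n - 1}`. -/
noncomputable def cost (d : ℕ → ℕ → ℝ) (n i : ℕ) : ℝ := ∑ x ∈ Finset.range n, d i x

/-- The sum of the distances between each point and its image under the cyclic shift by `r`. -/
noncomputable def shiftSum (d : ℕ → ℕ → ℝ) (n r : ℕ) : ℝ :=
  ∑ x ∈ Finset.range n, d x ((x + r) % n)

/-- Compute the cost of the point `c` in real variable 0. -/
def costProg (c : NExpr) : Prog := sumLoop (accumulate c (.var 3))

theorem wp_costProg {c : NExpr} {s : Store} {n p : ℕ} (hn : s.nat 0 0 = n) (hcost : c.cost ≤ 2)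
    (hc : ∀ s', Unchanged (costProg c) s s' → c.eval s' = p) (t : ℕ) :
    WP d (costProg c) s t (fun x t' => (x.real 0 0 = cost d n p ∧ t' ≤ t + 22 * n + 13) ∧
      Unchanged (costProg c) s x) 0 0 := by
  refine (wp_sumLoop (n := n) (B := 10) (g := fun i => d p i) rfl hn ?_ t).mono ?_ (by simp) le_rfl
  · intro s' t' hs' _
    refine wp_accumulate.mono ?_ (by simp) le_rfl
    rintro x t'' ⟨rfl, h⟩
    simp only [NExpr.cost] at h
    refine ⟨by rw [hc s' hs']; rfl, by omega⟩
  · rintro x t' ⟨⟨h1, h2⟩, h3⟩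
    exact ⟨⟨h1, h2⟩, h3⟩

/-- Compute in real variable 0 the shift sum for the shift kept in variable 5. -/
def shiftProg : Prog :=
  sumLoop (.ite (.natLT (.add (.var 3) (.var 5)) (.var 0))
    (accumulate (.var 3) (.add (.var 3) (.var 5)))
    (accumulate (.var 3) (.sub (.add (.var 3) (.var 5)) (.var 0))))

theorem wp_shiftProg {s : Store} {n r : ℕ} (hn : s.nat 0 0 = n) (hr : s.nat 5 0 = r) (hrn : r < n)
    (t : ℕ) :
    WP d shiftProg s t (fun x t' => (x.real 0 0 = shiftSum d n r ∧ t' ≤ t + 50 * n + 13) ∧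
      Unchanged shiftProg s x) 0 0 := by
  refine (wp_sumLoop (n := n) (B := 38) (g := fun x => d x ((x + r) % n)) rfl hn ?_ t).mono ?_
    (by simp) le_rfl
  · intro s' t' hs' hx
    have h0 : s'.nat 0 0 = n := by rw [hs'.nat 0 rfl, hn]
    have h5 : s'.nat 5 0 = r := by rw [hs'.nat 5 rfl, hr]
    refine WP.ite (fun hlt => ?_) (fun hlt => ?_)
    · simp only [BExpr.Holds, NExpr.eval, h0, h5] at hlt
      refine wp_accumulate.mono ?_ (by simp) le_rfl
      rintro x t'' ⟨rfl, h⟩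
      simp only [NExpr.cost, BExpr.cost] at h
      refine ⟨?_, by omega⟩
      simp only [NExpr.eval, h5, Nat.mod_eq_of_lt hlt]
    · simp only [BExpr.Holds, NExpr.eval, h0, h5, not_lt] at hlt
      refine wp_accumulate.mono ?_ (by simp) le_rfl
      rintro x t'' ⟨rfl, h⟩
      simp only [NExpr.cost, BExpr.cost] at h
      refine ⟨?_, by omega⟩
      simp only [NExpr.eval, h5, h0, Nat.mod_eq_sub_mod hlt,
        Nat.mod_eq_of_lt (show s'.nat 3 0 + r - n < n by omega)]
  · rintro x t' ⟨⟨h1, h2⟩, h3⟩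
    exact ⟨⟨h1, h2⟩, h3⟩

/-- If the point `c` is cheaper than the best one known (variable 1, with its cost in real
variable 1), make it the best one known. -/
def update (c : NExpr) : Prog :=
  .seq (costProg c) (.ite (.realLT (.var 0) (.var 1))
    (.seq (.setNat 1 (.lit 0) c) (.setReal 1 (.lit 0) (.var 0))) .skip)

theorem wp_update {c : NExpr} {s : Store} {n p : ℕ} (hn : s.nat 0 0 = n) (hcost : c.cost ≤ 2)
    (hc : ∀ s', Unchanged (costProg c) s s' → c.eval s' = p) (t : ℕ) :
    WP d (update c) s t (fun x t' => ((x.real 1 0 = min (s.real 1 0) (cost d n p) ∧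
      (x.nat 1 0 = p ∧ x.real 1 0 = cost d n p ∨
        x.nat 1 0 = s.nat 1 0 ∧ x.real 1 0 = s.real 1 0)) ∧ t' ≤ t + 22 * n + 30) ∧
      Unchanged (update c) s x) 0 0 := by
  apply WP.unchanged
  refine WP.seq_const (wp_costProg hn hcost hc t) ?_
  rintro x t' ⟨⟨h1, h2⟩, h3⟩
  have e1 : x.real 1 0 = s.real 1 0 := by rw [h3.real 1 rfl]
  have e2 : x.nat 1 0 = s.nat 1 0 := by rw [h3.nat 1 rfl]
  refine WP.ite (fun h => ?_) (fun h => ?_)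
  · simp only [BExpr.Holds, RExpr.eval, NExpr.eval, h1, e1] at h
    refine WP.seq_setNat (WP.setReal ⟨?_, ?_⟩ (by simp))
    · simp [Store.setNat, Store.setReal, RExpr.eval, NExpr.eval, h1, hc x h3, h.le]
    · simp [BExpr.cost, NExpr.cost, RExpr.cost]
      omega
  · simp only [BExpr.Holds, RExpr.eval, NExpr.eval, h1, e1, not_lt] at h
    refine WP.skip ⟨?_, ?_⟩ (by simp)
    · simp [e1, e2, h]
    · simp [BExpr.cost, NExpr.cost, RExpr.cost]
      omega

/-! ### Comparing two points by sampling -/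

/-- `d` is a pseudometric on `{0, …, n - 1}`. -/
structure IsPseudometric (d : ℕ → ℕ → ℝ) (n : ℕ) : Prop where
  self : ∀ i < n, d i i = 0
  symm : ∀ i < n, ∀ j < n, d i j = d j i
  triangle : ∀ i < n, ∀ j < n, ∀ k < n, d i k ≤ d i j + d j k

theorem IsPseudometric.nonneg {n : ℕ} (h : IsPseudometric d n) {i j : ℕ} (hi : i < n) (hj : j < n) :
    0 ≤ d i j := by
  have h1 := h.triangle i hi j hj i hi
  rw [h.self i hi, h.symm j hj i hi] at h1
  linarith

theorem IsPseudometric.cost_nonneg {n : ℕ} (h : IsPseudometric d n) {i : ℕ} (hi : i < n) :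
    0 ≤ cost d n i :=
  Finset.sum_nonneg fun _ hx => h.nonneg hi (Finset.mem_range.1 hx)

theorem IsPseudometric.mul_dist_le {n : ℕ} (h : IsPseudometric d n) {i j : ℕ} (hi : i < n)
    (hj : j < n) : n * d i j ≤ cost d n i + cost d n j := by
  unfold cost
  rw [← Finset.sum_add_distrib]
  calc (n : ℝ) * d i j = ∑ x ∈ Finset.range n, d i j := by simp
    _ ≤ _ := Finset.sum_le_sum fun x hx => by
      rw [h.symm j hj x (Finset.mem_range.1 hx)]
      exact h.triangle i hi x (Finset.mem_range.1 hx) j hj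

theorem IsPseudometric.abs_sub_le {n : ℕ} (h : IsPseudometric d n) {i j x : ℕ} (hi : i < n)
    (hj : j < n) (hx : x < n) : |d i x - d j x| ≤ d i j := by
  rw [abs_sub_le_iff]
  constructor
  · linarith [h.triangle i hi j hj x hx]
  · linarith [h.triangle j hj i hi x hx, h.symm i hi j hj]

/-- Adding one sample increases the mean squared deviation by at most the variance. -/
theorem sum_sq_deviation_le {n : ℕ} {Y : ℕ → ℝ} {m D : ℝ} (z : ℝ)
    (hm : ∑ v ∈ Finset.range n, Y v = n * m) (hD : ∀ v < n, |Y v| ≤ D) :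
    ∑ v ∈ Finset.range n, (z + (Y v - m)) ^ 2 ≤ n * (z ^ 2 + D ^ 2) := by
  have h1 : ∀ v ∈ Finset.range n, (z + (Y v - m)) ^ 2 ≤
      (z ^ 2 + D ^ 2) + ((2 * z - 2 * m) * (Y v - m) - m ^ 2) := fun v hv => by
    have := sq_le_sq' (neg_le_of_abs_le (hD v (Finset.mem_range.1 hv)))
      (le_of_abs_le (hD v (Finset.mem_range.1 hv)))
    nlinarith
  refine (Finset.sum_le_sum h1).trans ?_
  simp only [Finset.sum_add_distrib, Finset.sum_sub_distrib, ← Finset.mul_sum, hm,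
    Finset.sum_const, Finset.card_range, nsmul_eq_mul]
  have : 0 ≤ (n : ℝ) * m ^ 2 := by positivity
  nlinarith

theorem sum_ofReal_div_le {n : ℕ} (hn : 0 < n) {f : ℕ → ℝ} {b : ℝ} (hf : ∀ v < n, 0 ≤ f v)
    (h : ∑ v ∈ Finset.range n, f v ≤ n * b) :
    (∑ v ∈ Finset.range n, ENNReal.ofReal (f v)) / n ≤ ENNReal.ofReal b := by
  rw [← ENNReal.ofReal_sum_of_nonneg fun v hv => hf v (Finset.mem_range.1 hv),
    ← ENNReal.ofReal_natCast n, ← ENNReal.ofReal_div_of_pos (by exact_mod_cast hn)]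
  apply ENNReal.ofReal_le_ofReal
  rw [div_le_iff₀ (by exact_mod_cast hn)]
  linarith

theorem WP.seq_rand {q : Prog} {s : Store} {t : ℕ} {A : Store → ℕ → Prop}
    {f : Store → ℕ → ℝ≥0∞} {b : ℝ≥0∞} {a : ℕ} {i e : NExpr} (G : ℕ → ℝ≥0∞)
    (h : ∀ v ≤ e.eval s,
      WP d q (s.setNat a (i.eval s) v) (t + (i.cost + e.cost + 1)) A f (G v))
    (hG : (∑ v ∈ Finset.range (e.eval s + 1), G v) / (e.eval s + 1 : ℕ) ≤ b) :
    WP d (.seq (.rand a i e) q) s t A f b := by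
  refine WP.seq (g := fun x _ => G (x.nat a (i.eval s))) (WP.rand (fun v hv => ?_) ?_)
  · simpa [Store.setNat] using h v hv
  · simpa [Store.setNat] using hG

/-- One of the two contestants of a duel: the candidate in the slot kept in variable 8. -/
def loCand : NExpr := .get 6 (.var 8)

/-- The other contestant of a duel: the last candidate; their number is kept in variable 7. -/
def hiCand : NExpr := .get 6 (.sub (.var 7) (.lit 1))

/-- Draw random points until their number reaches real variable 3, and sum up in real variable 0
the distance to the first contestant minus the distance to the second one. -/
def sampleLoop : Prog :=
  .loop (.realLT (.ofNat (.var 4)) (.var 3))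
    (.seq (.rand 5 (.lit 0) (.sub (.var 0) (.lit 1)))
      (.seq (.setReal 0 (.lit 0)
        (.add (.var 0) (.sub (.query loCand (.var 5)) (.query hiCand (.var 5)))))
        (.setNat 4 (.lit 0) (.add (.var 4) (.lit 1)))))

/-- Each sample increases the expected squared deviation of the sum from its mean by at most
`D ^ 2`. -/
theorem wp_sampleLoop {s₀ : Store} {n a b : ℕ} {m D w : ℝ} (hw : 0 ≤ w) (hn : 0 < n)
    (hn₀ : s₀.nat 0 0 = n) (ha : s₀.nat 6 (s₀.nat 8 0) = a) (hb : s₀.nat 6 (s₀.nat 7 0 - 1) = b)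
    (hm : ∑ v ∈ Finset.range n, (d a v - d b v) = n * m) (hD : ∀ v < n, |d a v - d b v| ≤ D)
    (j : ℕ) (s : Store) (t : ℕ) (hs : Unchanged sampleLoop s₀ s)
    (hj : s.nat 4 0 + j = ⌈s₀.real 3 0⌉₊) :
    WP d sampleLoop s t (fun x t' => t' ≤ t + 50 * j + 10 ∧ Unchanged sampleLoop s₀ x)
      (fun x _ => ENNReal.ofReal (w * (x.real 0 0 - ⌈s₀.real 3 0⌉₊ * m) ^ 2))
      (ENNReal.ofReal (w * ((s.real 0 0 - s.nat 4 0 * m) ^ 2 + j * D ^ 2))) := by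
  induction j generalizing s t with
  | zero =>
    have h3 : s.real 3 0 = s₀.real 3 0 := by rw [hs.real 3 rfl]
    refine WP.loop_exit ?_ ⟨?_, hs⟩ ?_
    · simp only [BExpr.Holds, RExpr.eval, NExpr.eval, h3, ← Nat.lt_ceil]
      omega
    · simp [BExpr.cost, NExpr.cost, RExpr.cost]
    · rw [← hj]
      simp
  | succ j ih =>
    have h3 : s.real 3 0 = s₀.real 3 0 := by rw [hs.real 3 rfl]
    have h0 : s.nat 0 0 = n := by rw [hs.nat 0 rfl, hn₀]
    have hlo : s.nat 6 (s.nat 8 0) = a := by rw [hs.nat 6 rfl, hs.nat 8 rfl, ha]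
    have hhi : s.nat 6 (s.nat 7 0 - 1) = b := by rw [hs.nat 6 rfl, hs.nat 7 rfl, hb]
    have hlt : BExpr.Holds d s (.realLT (.ofNat (.var 4)) (.var 3)) := by
      simp only [BExpr.Holds, RExpr.eval, NExpr.eval, h3, ← Nat.lt_ceil]
      omega
    have hev : (NExpr.sub (.var 0) (.lit 1)).eval s + 1 = n := by
      simp only [NExpr.eval, h0]
      omega
    refine WP.loop_step (g := fun x _ =>
      ENNReal.ofReal (w * ((x.real 0 0 - x.nat 4 0 * m) ^ 2 + j * D ^ 2))) hlt
      (WP.seq_rand (fun v => ENNReal.ofReal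
        (w * ((s.real 0 0 - s.nat 4 0 * m + ((d a v - d b v) - m)) ^ 2 + j * D ^ 2))) ?_ ?_)
    · intro v hv
      refine WP.seq_setReal (WP.setNat ?_ ?_)
      · refine (ih _ _ ?_ ?_).mono ?_ (fun _ _ _ => le_rfl) le_rfl
        · exact ((hs.setNat rfl _ _).setReal rfl _ _).setNat rfl _ _
        · simp [Store.setNat, Store.setReal, NExpr.eval]
          omega
        · rintro x t' ⟨h, h'⟩
          refine ⟨h.trans ?_, h'⟩
          simp [BExpr.cost, NExpr.cost, RExpr.cost, loCand, hiCand]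
          omega
      · apply ENNReal.ofReal_le_ofReal
        simp only [Store.setNat, Store.setReal, NExpr.eval, RExpr.eval, loCand, hiCand]
        simp [hlo, hhi]
        apply le_of_eq
        ring
    · rw [hev]
      refine sum_ofReal_div_le hn (fun v _ => by positivity) ?_
      rw [← Finset.mul_sum, Finset.sum_add_distrib]
      have := sum_sq_deviation_le (s.real 0 0 - s.nat 4 0 * m) hm hD
      simp only [Finset.sum_const, Finset.card_range, nsmul_eq_mul]
      push_cast
      nlinarith [mul_le_mul_of_nonneg_left this hw]

/-- Replace the first contestant by the second one if the latter is closer to the sample. -/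
def duel : Prog :=
  .seq (.setReal 0 (.lit 0) (.ofNat (.lit 0))) (.seq (.setNat 4 (.lit 0) (.lit 0))
    (.seq sampleLoop (.ite (.realLT (.ofNat (.lit 0)) (.var 0)) (.setNat 6 (.var 8) hiCand) .skip)))

/-- What a duel does for certain, whoever wins it: `s` is the memory before and `x` after it. -/
def DuelResult (s x : Store) (t t' : ℕ) : Prop :=
  (x.nat 6 (s.nat 8 0) = s.nat 6 (s.nat 8 0) ∨ x.nat 6 (s.nat 8 0) = s.nat 6 (s.nat 7 0 - 1)) ∧
    (∀ i ≠ s.nat 8 0, x.nat 6 i = s.nat 6 i) ∧ (t' : ℝ) ≤ t + 150 * s.real 3 0 ∧ Unchanged duel s x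

theorem wp_duel_of_deviation {s : Store} {n a b : ℕ} {m D w : ℝ} (hw : 0 ≤ w) (hn : 0 < n)
    (hn₀ : s.nat 0 0 = n) (ha : s.nat 6 (s.nat 8 0) = a) (hb : s.nat 6 (s.nat 7 0 - 1) = b)
    (hk : 1 ≤ s.real 3 0)
    (hm : ∑ v ∈ Finset.range n, (d a v - d b v) = n * m) (hD : ∀ v < n, |d a v - d b v| ≤ D)
    (t : ℕ) (good : ℕ → Prop) [DecidablePred good]
    (hga : ¬ good a → ∀ z ≤ 0, 1 ≤ w * (z - ⌈s.real 3 0⌉₊ * m) ^ 2)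
    (hgb : ¬ good b → ∀ z > 0, 1 ≤ w * (z - ⌈s.real 3 0⌉₊ * m) ^ 2) :
    WP d duel s t (DuelResult s · t ·)
      (fun x _ => if good (x.nat 6 (s.nat 8 0)) then 0 else 1)
      (ENNReal.ofReal (w * (⌈s.real 3 0⌉₊ * D ^ 2))) := by
  refine (WP.unchanged (A := fun x t' => _ ∧ (∀ i ≠ s.nat 8 0, x.nat 6 i = s.nat 6 i) ∧
      (t' : ℝ) ≤ t + 150 * s.real 3 0) ?_).mono
    (fun x t' h => ⟨h.1.1, h.1.2.1, h.1.2.2, h.2⟩) (fun _ _ _ => le_rfl) le_rfl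
  refine WP.seq_setReal (WP.seq_setNat (WP.seq (g := fun x _ =>
    ENNReal.ofReal (w * (x.real 0 0 - ⌈s.real 3 0⌉₊ * m) ^ 2)) ?_))
  set s₁ := (s.setReal 0 ((NExpr.lit 0).eval s) ((RExpr.ofNat (.lit 0)).eval d s)).setNat 4
    ((NExpr.lit 0).eval (s.setReal 0 ((NExpr.lit 0).eval s) ((RExpr.ofNat (.lit 0)).eval d s)))
    ((NExpr.lit 0).eval (s.setReal 0 ((NExpr.lit 0).eval s) ((RExpr.ofNat (.lit 0)).eval d s)))
    with hs₁
  have hr3 : s₁.real 3 0 = s.real 3 0 := by simp [hs₁, Store.setNat, Store.setReal]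
  have hr0 : s₁.real 0 0 = 0 := by simp [hs₁, Store.setNat, Store.setReal, RExpr.eval, NExpr.eval]
  have h40 : s₁.nat 4 0 = 0 := by simp [hs₁, Store.setNat, NExpr.eval]
  have hnat : ∀ i ≠ 4, s₁.nat i = s.nat i := fun i hi => by
    funext j
    simp [hs₁, Store.setNat, Store.setReal, hi]
  have key := wp_sampleLoop (d := d) (s₀ := s₁) (a := a) (b := b) hw hn
    (by rw [hnat 0 (by decide), hn₀]) (by rw [hnat 6 (by decide), hnat 8 (by decide), ha])
    (by rw [hnat 6 (by decide), hnat 7 (by decide), hb]) hm hD _ s₁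
    (t + ((NExpr.lit 0).cost + (RExpr.ofNat (.lit 0)).cost + 1) +
      ((NExpr.lit 0).cost + (NExpr.lit 0).cost + 1)) (.refl _ _) (by rw [h40, zero_add])
  rw [hr3, hr0, h40] at key
  refine key.mono ?_ (fun _ _ _ => le_rfl) (by simp)
  rintro x t' ⟨ht', hx⟩
  have ht : (t' : ℝ) + 20 ≤ t + 150 * s.real 3 0 := by
    have h1 : (⌈s.real 3 0⌉₊ : ℝ) < s.real 3 0 + 1 := Nat.ceil_lt_add_one (by linarith)
    have h2 : (t' : ℝ) ≤ t + 17 + 50 * ⌈s.real 3 0⌉₊ := by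
      simp [NExpr.cost, RExpr.cost] at ht'
      exact_mod_cast (show t' ≤ t + 17 + 50 * ⌈s.real 3 0⌉₊ by omega)
    nlinarith
  have h6 : x.nat 6 = s.nat 6 := by rw [hx.nat 6 rfl, hnat 6 (by decide)]
  have h7 : x.nat 7 = s.nat 7 := by rw [hx.nat 7 rfl, hnat 7 (by decide)]
  have h8 : x.nat 8 = s.nat 8 := by rw [hx.nat 8 rfl, hnat 8 (by decide)]
  refine WP.ite (fun hlt => ?_) (fun hlt => ?_)
  · simp only [BExpr.Holds, RExpr.eval, NExpr.eval, Nat.cast_zero] at hlt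
    refine WP.setNat ⟨Or.inr ?_, ?_, ?_⟩ ?_
    · simp [Store.setNat, NExpr.eval, hiCand, h6, h7, h8]
    · intro i hi
      simp [Store.setNat, NExpr.eval, hiCand, h6, h8, hi]
    · simp [BExpr.cost, NExpr.cost, RExpr.cost, hiCand]
      linarith
    · simp only [Store.setNat, NExpr.eval, hiCand, h6, h7, h8, and_self, if_true, hb]
      split_ifs with hg
      · exact zero_le
      · exact ENNReal.one_le_ofReal.2 (hgb hg _ hlt)
  · simp only [BExpr.Holds, RExpr.eval, NExpr.eval, Nat.cast_zero, not_lt] at hlt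
    refine WP.skip ⟨Or.inl ?_, ?_, ?_⟩ ?_
    · rw [h6]
    · intro i _
      rw [h6]
    · simp [BExpr.cost, NExpr.cost, RExpr.cost]
      linarith
    · simp only [h6, ha]
      split_ifs with hg
      · exact zero_le
      · exact ENNReal.one_le_ofReal.2 (hga hg _ hlt)

/-- If one contestant costs at most `c * o` and the other one more than `(c + e) * o`, then the mean
of the difference is so large, compared with the distance of the contestants, that the wrong one
wins with probability `O(1 / (k * e ^ 2))`, for `k` samples. -/
theorem wp_duel {s : Store} {n : ℕ} {c e o : ℝ} (hd : IsPseudometric d n) (hn : 0 < n)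
    (hn₀ : s.nat 0 0 = n) (ha : s.nat 6 (s.nat 8 0) < n) (hb : s.nat 6 (s.nat 7 0 - 1) < n)
    (hk : 1 ≤ s.real 3 0) (hc : 0 ≤ c) (he : 0 < e) (hce : 2 * c + e ≤ 4) (ho : 0 ≤ o) (t : ℕ) :
    WP d duel s t (DuelResult s · t ·)
      (fun x _ => if cost d n (x.nat 6 (s.nat 8 0)) ≤ (c + e) * o then 0 else 1)
      (if cost d n (s.nat 6 (s.nat 8 0)) ≤ c * o ∨ cost d n (s.nat 6 (s.nat 7 0 - 1)) ≤ c * o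
        then ENNReal.ofReal (16 / (s.real 3 0 * e ^ 2)) else 1) := by
  set a := s.nat 6 (s.nat 8 0) with ha'
  set b := s.nat 6 (s.nat 7 0 - 1) with hb'
  have hn' : (0 : ℝ) < n := by exact_mod_cast hn
  set m := (cost d n a - cost d n b) / n with hm
  have hsum : ∑ v ∈ Finset.range n, (d a v - d b v) = n * m := by
    rw [hm, mul_div_cancel₀ _ hn'.ne', Finset.sum_sub_distrib]
    rfl
  have hD : ∀ v < n, |d a v - d b v| ≤ d a b := fun v hv => hd.abs_sub_le ha hb hv
  have hDn : (n : ℝ) * d a b ≤ cost d n a + cost d n b := hd.mul_dist_le ha hb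
  have hnm : (n : ℝ) * m = cost d n a - cost d n b := by rw [hm, mul_div_cancel₀ _ hn'.ne']
  have hD0 : 0 ≤ d a b := hd.nonneg ha hb
  set N := ⌈s.real 3 0⌉₊ with hN
  have hkN : s.real 3 0 ≤ N := Nat.le_ceil _
  have hN0 : (0 : ℝ) < N := by linarith
  have hk0 : 0 < s.real 3 0 := by linarith
  -- without a threshold to meet, the analysis of the samples is not needed
  have trivial_bound : ∀ (w : ℝ≥0∞) (F : Store → ℕ → ℝ≥0∞),
      (∀ x t', DuelResult s x t t' → F x t' ≤ w) → WP d duel s t (DuelResult s · t ·) F w :=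
    fun w F hF => (wp_duel_of_deviation (w := 0) le_rfl hn hn₀ ha'.symm hb'.symm hk hsum hD t
      (fun _ => True) (by simp) (by simp)).const fun x t' hx => ⟨hx, hF x t' hx⟩
  by_cases hbound : cost d n a ≤ c * o ∨ cost d n b ≤ c * o
  swap
  · rw [if_neg hbound]
    exact trivial_bound _ _ fun x t' _ => by split_ifs <;> simp
  rw [if_pos hbound]
  by_cases hgood : cost d n a ≤ (c + e) * o ∧ cost d n b ≤ (c + e) * o
  · refine trivial_bound _ _ fun x t' hx => ?_
    rw [if_pos]
    · exact zero_le
    · rcases hx.1 with h | h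
      · rw [h]; exact hgood.1
      · rw [h]; exact hgood.2
  have hco : c * o ≤ (c + e) * o := by nlinarith
  have hgap : ∀ {x y : ℝ}, x ≤ c * o → (c + e) * o < y → (x + y) * e ≤ 4 * (y - x) := by
    intro x y hx hy
    have h1 := mul_le_mul_of_nonneg_right hx (show (0 : ℝ) ≤ 4 + e by linarith)
    have h2 := mul_le_mul_of_nonneg_right hy.le (show (0 : ℝ) ≤ 4 - e by linarith)
    have h3 : 0 ≤ o * e * (4 - e - 2 * c) := mul_nonneg (mul_nonneg ho he.le) (by linarith)
    nlinarith
  have hbig : m ≠ 0 ∧ d a b * e ≤ 4 * |m| ∧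
      (¬ cost d n a ≤ (c + e) * o → 0 < m) ∧ (¬ cost d n b ≤ (c + e) * o → m < 0) := by
    rcases hbound with h | h
    · have hy : (c + e) * o < cost d n b := by
        by_contra hcon
        exact hgood ⟨h.trans hco, not_lt.1 hcon⟩
      have hneg : m < 0 := by
        have : (n : ℝ) * m < 0 := by rw [hnm]; linarith
        exact (pos_iff_neg_of_mul_neg this).1 hn'
      refine ⟨hneg.ne, ?_, fun h' => absurd (h.trans hco) h', fun _ => hneg⟩
      rw [abs_of_neg hneg]
      have := hgap h hy
      refine le_of_mul_le_mul_left ?_ hn'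
      nlinarith
    · have hy : (c + e) * o < cost d n a := by
        by_contra hcon
        exact hgood ⟨not_lt.1 hcon, h.trans hco⟩
      have hpos : 0 < m := by
        have : 0 < (n : ℝ) * m := by rw [hnm]; linarith
        exact (pos_iff_pos_of_mul_pos this).1 hn'
      refine ⟨hpos.ne', ?_, fun _ => hpos, fun h' => absurd (h.trans hco) h'⟩
      rw [abs_of_pos hpos]
      have := hgap h hy
      refine le_of_mul_le_mul_left ?_ hn'
      nlinarith
  obtain ⟨hm0, hDm, hma, hmb⟩ := hbig
  have hNm : 0 < (N * m) ^ 2 := by positivity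
  refine (wp_duel_of_deviation (w := 1 / (N * m) ^ 2) (by positivity) hn hn₀ ha'.symm hb'.symm hk
    hsum hD t (fun p => cost d n p ≤ (c + e) * o) (fun h z hz => ?_) (fun h z hz => ?_)).mono
    (fun _ _ h => h) (fun _ _ _ => le_rfl) (ENNReal.ofReal_le_ofReal ?_)
  · rw [one_div, ← div_eq_inv_mul, one_le_div hNm]
    have := mul_pos hN0 (hma h)
    nlinarith
  · rw [one_div, ← div_eq_inv_mul, one_le_div hNm]
    have := mul_neg_of_pos_of_neg hN0 (hmb h)
    nlinarith
  · rw [one_div, ← div_eq_inv_mul, div_le_div_iff₀ hNm (by positivity)]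
    have h1 : (d a b * e) ^ 2 ≤ 16 * m ^ 2 := by
      have := pow_le_pow_left₀ (mul_nonneg hD0 he.le) hDm 2
      rwa [mul_pow 4, sq_abs, show (4 : ℝ) ^ 2 = 16 by norm_num] at this
    calc N * d a b ^ 2 * (s.real 3 0 * e ^ 2) = N * s.real 3 0 * (d a b * e) ^ 2 := by ring
      _ ≤ N * N * (16 * m ^ 2) := by gcongr
      _ = 16 * (N * m) ^ 2 := by ring

/-! ### The knockout tournament -/

/-- Play one round: while there are two candidates left that have not played in this round, the
first and the last of them meet, and the winner takes the slot of the first one. -/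
def sweepLoop : Prog :=
  .loop (.natLT (.add (.var 8) (.lit 1)) (.var 7))
    (.seq duel (.seq (.setNat 7 (.lit 0) (.sub (.var 7) (.lit 1)))
      (.setNat 8 (.lit 0) (.add (.var 8) (.lit 1)))))

/-- All current candidates are points of the space. -/
def ValidCandidates (n : ℕ) (s : Store) : Prop := ∀ i < s.nat 7 0, s.nat 6 i < n

/-- A bound for the probability that the current round ends without a candidate of cost at most `w`, if it
started with one of cost at most `v` and a duel fails with probability at most `δ`.  Only the duel
that the cheap candidate takes part in can spoil the round. -/
noncomputable def sweepLoss (d : ℕ → ℕ → ℝ) (n : ℕ) (v w : ℝ) (δ : ℝ≥0∞) (s : Store) : ℝ≥0∞ :=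
  open Classical in
  if ∃ i < s.nat 8 0, cost d n (s.nat 6 i) ≤ w then 0
  else if ∃ i < s.nat 7 0, cost d n (s.nat 6 i) ≤ v then δ else 1

open Classical in
theorem wp_sweepLoop {s₀ : Store} {n : ℕ} {c e o : ℝ} (hd : IsPseudometric d n) (hn : 0 < n)
    (hn₀ : s₀.nat 0 0 = n) (hk : 1 ≤ s₀.real 3 0) (hc : 0 ≤ c) (he : 0 < e) (hce : 2 * c + e ≤ 4)
    (ho : 0 ≤ o) {δ : ℝ≥0∞} (hδ : ENNReal.ofReal (16 / (s₀.real 3 0 * e ^ 2)) ≤ δ) (hδ1 : δ ≤ 1)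
    (h : ℕ) (s : Store) (t : ℕ) (hs : Unchanged sweepLoop s₀ s)
    (hlo : s.nat 8 0 ≤ s.nat 7 0) (hpos : 0 < s.nat 7 0) (hh : (s.nat 7 0 - s.nat 8 0) / 2 = h)
    (hv : ValidCandidates n s) :
    WP d sweepLoop s t (fun x t' => x.nat 7 0 = s.nat 7 0 - h ∧ ValidCandidates n x ∧
        (t' : ℝ) ≤ t + 170 * s₀.real 3 0 * h + 10 ∧ Unchanged sweepLoop s₀ x)
      (fun x _ => if ∃ i < x.nat 7 0, cost d n (x.nat 6 i) ≤ (c + e) * o then 0 else 1)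
      (sweepLoss d n (c * o) ((c + e) * o) δ s) := by
  have hco : c * o ≤ (c + e) * o := by nlinarith
  induction h generalizing s t with
  | zero =>
    refine WP.loop_exit ?_ ⟨rfl, hv, ?_, hs⟩ ?_
    · simp only [BExpr.Holds, NExpr.eval]
      omega
    · simp [BExpr.cost, NExpr.cost]
      norm_num
    · unfold sweepLoss
      by_cases h1 : ∃ i < s.nat 7 0, cost d n (s.nat 6 i) ≤ (c + e) * o
      · rw [if_pos h1]
        exact zero_le
      · have h2 : ¬ ∃ i < s.nat 8 0, cost d n (s.nat 6 i) ≤ (c + e) * o :=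
          fun ⟨i, hi, hi'⟩ => h1 ⟨i, by omega, hi'⟩
        have h3 : ¬ ∃ i < s.nat 7 0, cost d n (s.nat 6 i) ≤ c * o :=
          fun ⟨i, hi, hi'⟩ => h1 ⟨i, hi, hi'.trans hco⟩
        rw [if_neg h1, if_neg h2, if_neg h3]
  | succ h ih =>
    have hlt : BExpr.Holds d s (.natLT (.add (.var 8) (.lit 1)) (.var 7)) := by
      simp only [BExpr.Holds, NExpr.eval]
      omega
    have hk3 : s.real 3 0 = s₀.real 3 0 := by rw [hs.real 3 rfl]
    have hn' : s.nat 0 0 = n := by rw [hs.nat 0 rfl, hn₀]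
    have hduel := wp_duel (s := s) (c := c) (e := e) (o := o) hd hn hn' (hv _ (by omega))
      (hv _ (by omega)) (by rw [hk3]; exact hk) hc he hce ho
      (t + ((BExpr.natLT (.add (.var 8) (.lit 1)) (.var 7)).cost + 1))
    -- memory after the duel and the two counter updates
    let next : Store → Store := fun x =>
      (x.setNat 7 0 (s.nat 7 0 - 1)).setNat 8 0 (s.nat 8 0 + 1)
    have next6 : ∀ x, (next x).nat 6 = x.nat 6 := fun x => by
      funext i
      simp [next, Store.setNat]
    have next7 : ∀ x, (next x).nat 7 0 = s.nat 7 0 - 1 := fun x => by simp [next, Store.setNat]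
    have next8 : ∀ x, (next x).nat 8 0 = s.nat 8 0 + 1 := fun x => by simp [next, Store.setNat]
    suffices hmain : WP d duel s (t + ((BExpr.natLT (.add (.var 8) (.lit 1)) (.var 7)).cost + 1))
        (DuelResult s · (t + ((BExpr.natLT (.add (.var 8) (.lit 1)) (.var 7)).cost + 1)) ·)
        (fun x _ => sweepLoss d n (c * o) ((c + e) * o) δ (next x))
        (sweepLoss d n (c * o) ((c + e) * o) δ s) by
      refine WP.loop_step (g := fun x _ => sweepLoss d n (c * o) ((c + e) * o) δ x) hlt
        (WP.seq (hmain.mono ?_ (fun _ _ _ => le_rfl) le_rfl))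
      rintro x t' ⟨h1, h2, h3, h4⟩
      have h7 : x.nat 7 0 = s.nat 7 0 := by rw [h4.nat 7 rfl]
      have h8 : x.nat 8 0 = s.nat 8 0 := by rw [h4.nat 8 rfl]
      refine WP.seq_setNat (WP.setNat ?_ ?_)
      · have hx : ((x.setNat 7 ((NExpr.lit 0).eval x) ((NExpr.sub (.var 7) (.lit 1)).eval x)).setNat
            8 ((NExpr.lit 0).eval (x.setNat 7 ((NExpr.lit 0).eval x)
              ((NExpr.sub (.var 7) (.lit 1)).eval x)))
            ((NExpr.add (.var 8) (.lit 1)).eval (x.setNat 7 ((NExpr.lit 0).eval x)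
              ((NExpr.sub (.var 7) (.lit 1)).eval x)))) = next x := by
          simp [next, NExpr.eval, h7, Store.setNat, h8]
        rw [hx]
        refine (ih (next x) _ ?_ ?_ ?_ ?_ ?_).mono ?_ (fun _ _ _ => le_rfl) le_rfl
        · exact ((hs.trans (h4.of_imp (by simp +contextual [sweepLoop, Prog.setsNat])
            (by simp +contextual [sweepLoop, Prog.setsReal]))).setNat rfl _ _).setNat rfl _ _
        · rw [next7, next8]; omega
        · rw [next7]; omega
        · rw [next7, next8]; omega
        · intro i hi
          rw [next7] at hi
          rw [next6]
          by_cases hi' : i = s.nat 8 0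
          · subst hi'
            rcases h1 with h1 | h1 <;> rw [h1] <;> exact hv _ (by omega)
          · rw [h2 i hi']
            exact hv _ (by omega)
        · rintro y t'' ⟨g1, g2, g3, g4⟩
          refine ⟨?_, g2, ?_, g4⟩
          · rw [g1, next7]; omega
          · simp only [BExpr.cost, NExpr.cost, hk3] at h3 g3
            push_cast at h3 g3 ⊢
            linarith
      · refine le_of_eq (congrArg _ ?_)
        simp [next, NExpr.eval, h7, Store.setNat, h8]
    by_cases c1 : ∃ i < s.nat 8 0, cost d n (s.nat 6 i) ≤ (c + e) * o
    · obtain ⟨i, hi, hi'⟩ := c1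
      refine hduel.const fun x t' hx => ⟨hx, ?_⟩
      unfold sweepLoss
      rw [if_pos ⟨i, by rw [next8]; omega, by rw [next6, hx.2.1 i hi.ne]; exact hi'⟩]
      exact zero_le
    have hb : sweepLoss d n (c * o) ((c + e) * o) δ s =
        if ∃ i < s.nat 7 0, cost d n (s.nat 6 i) ≤ c * o then δ else 1 := by
      unfold sweepLoss
      rw [if_neg c1]
    rw [hb]
    by_cases c2 : ∃ i < s.nat 7 0, cost d n (s.nat 6 i) ≤ c * o
    swap
    · rw [if_neg c2]
      refine hduel.const fun x t' hx => ⟨hx, ?_⟩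
      unfold sweepLoss
      split_ifs
      · exact zero_le
      · exact hδ1
      · exact le_rfl
    rw [if_pos c2]
    obtain ⟨i, hi, hi'⟩ := c2
    have hilo : s.nat 8 0 ≤ i := by
      by_contra hcon
      exact c1 ⟨i, not_le.1 hcon, hi'.trans hco⟩
    by_cases c3 : i = s.nat 8 0 ∨ i = s.nat 7 0 - 1
    · refine hduel.mono (fun _ _ h => h) (fun x t' hx => ?_) ?_
      · unfold sweepLoss
        by_cases hwin : cost d n (x.nat 6 (s.nat 8 0)) ≤ (c + e) * o
        · rw [if_pos hwin, if_pos ⟨s.nat 8 0, by rw [next8]; omega, by rw [next6]; exact hwin⟩]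
        · rw [if_neg hwin]
          split_ifs
          · exact zero_le
          · exact hδ1
          · exact le_rfl
      · rw [if_pos, hk3]
        · exact hδ
        · rcases c3 with rfl | rfl
          · exact Or.inl hi'
          · exact Or.inr hi'
    · rw [not_or] at c3
      refine hduel.const fun x t' hx => ⟨hx, ?_⟩
      unfold sweepLoss
      split_ifs with g1 g2
      · exact zero_le
      · exact le_rfl
      · exact absurd ⟨i, by rw [next7]; omega, by rw [next6, hx.2.1 i c3.1]; exact hi'⟩ g2

/-- Rounds of the tournament, the number of samples per duel (real variable 3) growing by the factor
`3 / 2` from one to the next.  Since the number of candidates is halved, the total cost is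
dominated by the first round, while the accuracy of the duels improves geometrically. -/
def tourLoop : Prog :=
  .loop (.natLT (.lit 1) (.var 7)) (.seq (.seq (.setNat 8 (.lit 0) (.lit 0)) sweepLoop)
    (.setReal 3 (.lit 0) (.add (.var 3) (.div (.var 3) (.ofNat (.lit 2))))))

/-- The factor above the optimum that is tolerated after `j` rounds of the tournament. -/
noncomputable def tolerance (η : ℝ) (j : ℕ) : ℝ := 1 + η * (1 - (7 / 8) ^ j)

theorem tolerance_succ (η : ℝ) (j : ℕ) :
    tolerance η (j + 1) = tolerance η j + η * (7 / 8) ^ j / 8 := by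
  unfold tolerance
  rw [pow_succ]
  ring

theorem tolerance_le {η : ℝ} (hη : 0 ≤ η) (j : ℕ) : tolerance η j ≤ 1 + η := by
  unfold tolerance
  have : 0 ≤ η * (7 / 8) ^ j := by positivity
  linarith

theorem one_le_tolerance {η : ℝ} (hη : 0 ≤ η) (j : ℕ) : 1 ≤ tolerance η j := by
  unfold tolerance
  have h1 : ((7 : ℝ) / 8) ^ j ≤ 1 := pow_le_one₀ (by norm_num) (by norm_num)
  nlinarith

/-- The failure probability of the duel that matters in round `j`. -/
theorem duel_failure_eq {k₀ η : ℝ} (hk : 0 < k₀) (hη : 0 < η) (j : ℕ) :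
    16 / (k₀ * (3 / 2) ^ j * (η * (7 / 8) ^ j / 8) ^ 2) =
      1024 / (k₀ * η ^ 2) * (128 / 147) ^ j := by
  have h1 : ((128 : ℝ) / 147) ^ j = 1 / ((3 / 2) ^ j * ((7 / 8) ^ j) ^ 2) := by
    rw [← pow_mul, mul_comm j 2, pow_mul, ← mul_pow, ← one_div_pow]
    norm_num
  rw [h1]
  field_simp
  norm_num

open Classical in
/-- The failure probabilities of the rounds from `j` on form a geometric series. -/
theorem wp_tourLoop {s₀ : Store} {n : ℕ} {k₀ η o : ℝ} (hd : IsPseudometric d n) (hn : 0 < n)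
    (hn₀ : s₀.nat 0 0 = n) (hk : 1 ≤ k₀) (hη : 0 < η) (hη1 : η ≤ 1 / 2) (ho : 0 ≤ o)
    (hkη : 8192 ≤ k₀ * η ^ 2) (m : ℕ) (hm : 0 < m) (j : ℕ) (s : Store) (t : ℕ)
    (hs : Unchanged tourLoop s₀ s) (hm7 : s.nat 7 0 = m) (hk3 : s.real 3 0 = k₀ * (3 / 2) ^ j)
    (hv : ValidCandidates n s) :
    WP d tourLoop s t (fun x t' => x.nat 6 0 < n ∧
        (t' : ℝ) ≤ t + 500 * (m - 1) * s.real 3 0 + 10 ∧ Unchanged tourLoop s₀ x)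
      (fun x _ => if cost d n (x.nat 6 0) ≤ (1 + η) * o then 0 else 1)
      (if ∃ i < m, cost d n (s.nat 6 i) ≤ tolerance η j * o
        then ENNReal.ofReal (1024 / (k₀ * η ^ 2) * (147 / 19) * (128 / 147) ^ j) else 1) := by
  induction m using Nat.strong_induction_on generalizing j s t with
  | _ m ih =>
  by_cases h1m : 1 < m
  swap
  · obtain rfl : m = 1 := by omega
    refine WP.loop_exit ?_ ⟨hv 0 (by omega), ?_, hs⟩ ?_
    · simp only [BExpr.Holds, NExpr.eval]
      omega
    · simp [BExpr.cost, NExpr.cost]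
      norm_num
    · by_cases hc : cost d n (s.nat 6 0) ≤ (1 + η) * o
      · rw [if_pos hc]
        exact zero_le
      · rw [if_neg hc, if_neg]
        rintro ⟨i, hi, hi'⟩
        obtain rfl : i = 0 := by omega
        exact hc (hi'.trans (mul_le_mul_of_nonneg_right (tolerance_le hη.le j) ho))
  have hlt : BExpr.Holds d s (.natLT (.lit 1) (.var 7)) := by
    simp only [BExpr.Holds, NExpr.eval]
    omega
  have hpow : (1 : ℝ) ≤ (3 / 2) ^ j := one_le_pow₀ (by norm_num)
  have hk1 : 1 ≤ s.real 3 0 := by rw [hk3]; nlinarith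
  have hq0 : (0 : ℝ) < (7 / 8) ^ j := by positivity
  have hq1 : ((7 : ℝ) / 8) ^ j ≤ 1 := pow_le_one₀ (by norm_num) (by norm_num)
  have hρ1 : ((128 : ℝ) / 147) ^ j ≤ 1 := pow_le_one₀ (by norm_num) (by norm_num)
  have hρ0 : (0 : ℝ) < (128 / 147) ^ j := by positivity
  have hkη0 : 0 < k₀ * η ^ 2 := by positivity
  have hF : 1024 / (k₀ * η ^ 2) ≤ 1 := by
    rw [div_le_one hkη0]
    linarith
  set F := 1024 / (k₀ * η ^ 2) with hF'
  have hF0 : 0 < F := by positivity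
  set e := η * (7 / 8) ^ j / 8 with he
  have he0 : 0 < e := by positivity
  have heη : e ≤ 1 / 8 := by
    rw [he]
    nlinarith
  set h := m / 2 with hh
  set s₁ := s.setNat 8 ((NExpr.lit 0).eval s) ((NExpr.lit 0).eval s) with hs₁
  have hnat : ∀ i ≠ 8, s₁.nat i = s.nat i := fun i hi => by
    funext j
    simp [hs₁, Store.setNat, hi]
  have h8 : s₁.nat 8 0 = 0 := by simp [hs₁, Store.setNat, NExpr.eval]
  have hr : s₁.real = s.real := rfl
  have hδ : 16 / (s₁.real 3 0 * e ^ 2) = F * (128 / 147) ^ j := by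
    rw [hr, hk3, duel_failure_eq (by linarith) hη]
  have hsweep := wp_sweepLoop (s₀ := s₁) (c := tolerance η j) (e := e) (o := o)
    (δ := ENNReal.ofReal (F * (128 / 147) ^ j)) hd hn
    (by rw [hnat 0 (by decide), hs.nat 0 rfl, hn₀]) (by rw [hr]; exact hk1)
    (by linarith [one_le_tolerance hη.le j]) he0 (by linarith [tolerance_le hη.le j]) ho
    (by rw [hδ]) (ENNReal.ofReal_le_one.2 (by nlinarith)) h s₁
    (t + ((BExpr.natLT (.lit 1) (.var 7)).cost + 1) +
      ((NExpr.lit 0).cost + (NExpr.lit 0).cost + 1)) (.refl _ _) (by omega)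
    (by rw [hnat 7 (by decide)]; omega) (by rw [hnat 7 (by decide), h8, hm7, hh, Nat.sub_zero])
    (fun i hi => by
      rw [hnat 7 (by decide)] at hi
      rw [hnat 6 (by decide)]
      exact hv i hi)
  rw [hnat 7 (by decide), hm7, ← tolerance_succ, hr] at hsweep
  have hloss : sweepLoss d n (tolerance η j * o) (tolerance η (j + 1) * o)
      (ENNReal.ofReal (F * (128 / 147) ^ j)) s₁ =
      if ∃ i < m, cost d n (s.nat 6 i) ≤ tolerance η j * o
        then ENNReal.ofReal (F * (128 / 147) ^ j) else 1 := by
    unfold sweepLoss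
    rw [if_neg (by simp [h8]), hnat 7 (by decide), hm7, hnat 6 (by decide)]
  rw [hloss] at hsweep
  -- the loss bound after the round, as an upper bound on what the induction hypothesis gives
  set R := ENNReal.ofReal (F * (147 / 19) * (128 / 147) ^ (j + 1)) with hR
  have hsplit : ENNReal.ofReal (F * (128 / 147) ^ j) + R =
      ENNReal.ofReal (F * (147 / 19) * (128 / 147) ^ j) := by
    rw [hR, ← ENNReal.ofReal_add (by positivity) (by positivity)]
    congr 1
    rw [pow_succ]
    ring
  suffices hmain : WP d sweepLoop s₁ (t + ((BExpr.natLT (.lit 1) (.var 7)).cost + 1) +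
      ((NExpr.lit 0).cost + (NExpr.lit 0).cost + 1)) (fun x t' => x.nat 7 0 = m - h ∧
        ValidCandidates n x ∧ (t' : ℝ) ≤ (t + ((BExpr.natLT (.lit 1) (.var 7)).cost + 1) +
      ((NExpr.lit 0).cost + (NExpr.lit 0).cost + 1) : ℕ) + 170 * s.real 3 0 * h + 10 ∧
        Unchanged sweepLoop s₁ x)
      (fun x _ => if ∃ i < x.nat 7 0, cost d n (x.nat 6 i) ≤ tolerance η (j + 1) * o then R else 1)
      (if ∃ i < m, cost d n (s.nat 6 i) ≤ tolerance η j * o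
        then ENNReal.ofReal (F * (147 / 19) * (128 / 147) ^ j) else 1) by
    refine WP.loop_step (g := fun x _ =>
      if ∃ i < x.nat 7 0, cost d n (x.nat 6 i) ≤ tolerance η (j + 1) * o then R else 1) hlt
      (WP.seq (WP.seq_setNat (hmain.mono ?_ (fun _ _ _ => le_rfl) le_rfl)))
    rintro x t' ⟨h1, h2, h3, h4⟩
    have hx3 : x.real 3 0 = s.real 3 0 := by rw [h4.real 3 rfl, hr]
    refine WP.setReal ?_ le_rfl
    set y := x.setReal 3 ((NExpr.lit 0).eval x)
      ((RExpr.add (.var 3) (.div (.var 3) (.ofNat (.lit 2)))).eval d x) with hy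
    have hy3 : y.real 3 0 = s.real 3 0 * (3 / 2) := by
      simp only [hy, Store.setReal, NExpr.eval, RExpr.eval, hx3, and_self, if_true]
      push_cast
      ring
    have hyn : y.nat = x.nat := rfl
    have hm' : x.nat 7 0 = m - h := h1
    have := ih (m - h) (by omega) (by omega) (j + 1) y
      (t' + ((NExpr.lit 0).cost + (RExpr.add (.var 3) (.div (.var 3) (.ofNat (.lit 2)))).cost + 1))
      ?_ (by rw [hyn, h1]) (by rw [hy3, hk3, pow_succ]; ring) ?_
    · rw [hyn, ← hm'] at this
      refine this.mono ?_ (fun _ _ _ => le_rfl) le_rfl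
      rintro z t'' ⟨g1, g2, g3⟩
      refine ⟨g1, ?_, g3⟩
      rw [hm', hy3] at g2
      have hcast : ((m - h : ℕ) : ℝ) = m - h := by
        push_cast [Nat.cast_sub (show h ≤ m by omega)]
        ring
      have hmh : (m : ℝ) ≤ 2 * h + 1 := by exact_mod_cast (show m ≤ 2 * h + 1 by omega)
      have hh1 : (1 : ℝ) ≤ h := by exact_mod_cast (show 1 ≤ h by omega)
      rw [hcast] at g2
      simp only [BExpr.cost, NExpr.cost, RExpr.cost] at g2 h3
      push_cast at g2 h3
      have p1 : 0 ≤ s.real 3 0 * (2 * h + 1 - m) := mul_nonneg (by linarith) (by linarith)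
      have p2 : 0 ≤ (s.real 3 0 - 1) * h := mul_nonneg (by linarith) (by linarith)
      nlinarith
    · exact ((hs.setNat (a := 8) rfl _ _).trans (h4.of_imp (q := tourLoop)
        (by simp +contextual [tourLoop, sweepLoop, Prog.setsNat])
        (by simp +contextual [tourLoop, sweepLoop, Prog.setsReal]))).setReal rfl _ _
    · intro i hi
      exact h2 i hi
  by_cases hal : ∃ i < m, cost d n (s.nat 6 i) ≤ tolerance η j * o
  · rw [if_pos hal] at hsweep ⊢
    refine (hsweep.add_const R).mono (fun x t' hx => ?_) (fun x t' hx => ?_) hsplit.le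
    · obtain ⟨h1, h2, h3, h4⟩ := hx
      exact ⟨h1, h2, h3, h4⟩
    · split_ifs
      · simp
      · exact le_self_add
  · rw [if_neg hal]
    refine hsweep.const fun x t' hx => ⟨?_, ?_⟩
    · obtain ⟨h1, h2, h3, h4⟩ := hx
      exact ⟨h1, h2, h3, h4⟩
    · split_ifs
      · rw [hR]
        apply ENNReal.ofReal_le_one.2
        have : ((128 : ℝ) / 147) ^ (j + 1) ≤ 1 := pow_le_one₀ (by norm_num) (by norm_num)
        have h3 : F ≤ 1 / 8 := by
          rw [hF', div_le_iff₀ hkη0]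
          linarith
        have h4 : F * (147 / 19) ≤ 1 := by linarith
        have h5 : (0 : ℝ) < (128 / 147) ^ (j + 1) := by positivity
        nlinarith
      · exact le_rfl

/-- Make every point of the space a candidate. -/
def fillLoop : Prog :=
  .loop (.natLT (.var 3) (.var 0))
    (.seq (.setNat 6 (.var 3) (.var 3)) (.setNat 3 (.lit 0) (.add (.var 3) (.lit 1))))

theorem wp_fillLoop {s₀ : Store} {n : ℕ} (hn₀ : s₀.nat 0 0 = n) (k : ℕ) (s : Store) (t : ℕ)
    (hs : Unchanged fillLoop s₀ s) (hk : s.nat 3 0 + k = n)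
    (hc : ∀ i < s.nat 3 0, s.nat 6 i = i) :
    WP d fillLoop s t (fun x t' => (∀ i < n, x.nat 6 i = i) ∧ t' ≤ t + 20 * k + 6 ∧
      Unchanged fillLoop s₀ x) 0 0 := by
  induction k generalizing s t with
  | zero =>
    have hn' : s.nat 0 0 = n := by rw [hs.nat 0 rfl, hn₀]
    refine WP.loop_exit ?_ ⟨?_, ?_, hs⟩ (by simp)
    · simp only [BExpr.Holds, NExpr.eval, hn']
      omega
    · intro i hi
      exact hc i (by omega)
    · simp [BExpr.cost, NExpr.cost]
  | succ k ih =>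
    have hn' : s.nat 0 0 = n := by rw [hs.nat 0 rfl, hn₀]
    have hlt : BExpr.Holds d s (.natLT (.var 3) (.var 0)) := by
      simp only [BExpr.Holds, NExpr.eval, hn']
      omega
    refine WP.loop_step_const hlt (WP.seq_setNat (WP.setNat ?_ (by simp)))
    refine (ih _ _ ?_ ?_ ?_).mono ?_ (by simp) le_rfl
    · exact (hs.setNat rfl _ _).setNat rfl _ _
    · simp [Store.setNat, NExpr.eval]
      omega
    · intro i hi
      simp [Store.setNat, NExpr.eval] at hi ⊢
      split_ifs with hne
      · exact hne.symm
      · exact hc i (by omega)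
    · rintro x t' ⟨h1, h2, h3⟩
      refine ⟨h1, h2.trans ?_, h3⟩
      simp [BExpr.cost, NExpr.cost]
      omega

/-- The whole tournament, with `k₀` samples per duel in the first round; its winner is left as
candidate 0. -/
def tournament (k₀ : ℕ) : Prog :=
  .seq (.setNat 3 (.lit 0) (.lit 0)) (.seq fillLoop (.seq (.setNat 7 (.lit 0) (.var 0))
    (.seq (.setReal 3 (.lit 0) (.ofNat (.lit k₀))) tourLoop)))

theorem wp_tournament {s : Store} {n k₀ : ℕ} {η o : ℝ} (hd : IsPseudometric d n) (hn : 0 < n)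
    (hn₀ : s.nat 0 0 = n) (hk : 1 ≤ k₀) (hη : 0 < η) (hη1 : η ≤ 1 / 2) (ho : 0 ≤ o)
    (hopt : ∃ i < n, cost d n i ≤ o) (hkη : 32768 ≤ k₀ * η ^ 2) (t : ℕ) :
    WP d (tournament k₀) s t (fun x t' => (x.nat 6 0 < n ∧ t' ≤ t + 500 * k₀ * n + 20 * n + 50) ∧
        Unchanged (tournament k₀) s x)
      (fun x _ => if cost d n (x.nat 6 0) ≤ (1 + η) * o then 0 else 1) (1 / 4) := by
  apply WP.unchanged
  have hk' : (1 : ℝ) ≤ k₀ := by exact_mod_cast hk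
  set s₁ := s.setNat 3 ((NExpr.lit 0).eval s) ((NExpr.lit 0).eval s) with hs₁
  have h3 : s₁.nat 3 0 = 0 := by simp [hs₁, Store.setNat, NExpr.eval]
  have h0 : s₁.nat 0 0 = n := by simp [hs₁, Store.setNat, hn₀]
  refine WP.seq_setNat (WP.seq_const (wp_fillLoop (s₀ := s₁) (n := n) h0 n s₁ _ (.refl _ _)
    (by rw [h3, zero_add]) (by simp [h3])) ?_)
  rintro x t' ⟨g1, g2, g3⟩
  refine WP.seq_setNat (WP.seq_setReal ?_)
  set y := (x.setNat 7 ((NExpr.lit 0).eval x) ((NExpr.var 0).eval x)).setReal 3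
    ((NExpr.lit 0).eval (x.setNat 7 ((NExpr.lit 0).eval x) ((NExpr.var 0).eval x)))
    ((RExpr.ofNat (.lit k₀)).eval d (x.setNat 7 ((NExpr.lit 0).eval x) ((NExpr.var 0).eval x)))
    with hy
  have hx0 : x.nat 0 0 = n := by rw [g3.nat 0 rfl, h0]
  have hy0 : y.nat 0 0 = n := by simp [hy, Store.setNat, Store.setReal, hx0]
  have hy7 : y.nat 7 0 = n := by simp [hy, Store.setNat, Store.setReal, NExpr.eval, hx0]
  have hy6 : y.nat 6 = x.nat 6 := by
    funext i
    simp [hy, Store.setNat, Store.setReal]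
  have hy3 : y.real 3 0 = k₀ := by simp [hy, Store.setNat, Store.setReal, NExpr.eval, RExpr.eval]
  refine (wp_tourLoop (s₀ := y) (k₀ := k₀) (η := η) (o := o) hd hn hy0 hk' hη hη1 ho (by linarith) n
    hn 0 y _ (.refl _ _) hy7 (by rw [hy3, pow_zero, mul_one]) ?_).mono ?_ (fun _ _ _ => le_rfl) ?_
  · intro i hi
    rw [hy7] at hi
    rw [hy6, g1 i hi]
    exact hi
  · rintro z t'' ⟨f1, f2, -⟩
    refine ⟨f1, ?_⟩
    rw [hy3] at f2
    simp [NExpr.cost, RExpr.cost] at g2 f2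
    have hg : (t' : ℝ) ≤ t + 20 * n + 9 := by
      exact_mod_cast (show t' ≤ t + 20 * n + 9 by omega)
    have : (t'' : ℝ) ≤ t + 500 * k₀ * n + 20 * n + 50 := by nlinarith
    exact_mod_cast this
  · rw [if_pos]
    · have h1 : 1024 / ((k₀ : ℝ) * η ^ 2) ≤ 1 / 32 := by
        rw [div_le_div_iff₀ (by positivity) (by norm_num)]
        linarith
      refine (ENNReal.ofReal_le_ofReal (q := 1 / 4) ?_).trans (le_of_eq ?_)
      · rw [pow_zero, mul_one]
        linarith
      · rw [ENNReal.ofReal_div_of_pos (by norm_num)]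
        simp
    · obtain ⟨i, hi, hi'⟩ := hopt
      refine ⟨i, hi, ?_⟩
      rw [hy6, g1 i hi]
      simpa [tolerance] using hi'

/-! ### Random shifts certify a lower bound on the optimum -/

theorem sum_range_add_mod {n : ℕ} (hn : 0 < n) (g : ℕ → ℝ) (r : ℕ) :
    ∑ x ∈ Finset.range n, g ((x + r) % n) = ∑ x ∈ Finset.range n, g x := by
  have : NeZero n := ⟨hn.ne'⟩
  rw [Finset.sum_range, Finset.sum_range]
  refine Fintype.sum_equiv (Equiv.addRight (Fin.ofNat n r)) _ _ fun x => ?_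
  simp [Fin.val_add, Fin.ofNat]

theorem shiftSum_le {n : ℕ} (hd : IsPseudometric d n) (hn : 0 < n) {p : ℕ} (hp : p < n) (r : ℕ) :
    shiftSum d n r ≤ 2 * cost d n p := by
  have h : ∀ x ∈ Finset.range n, d x ((x + r) % n) ≤ d p x + d p ((x + r) % n) := fun x hx => by
    rw [hd.symm p hp x (Finset.mem_range.1 hx)]
    exact hd.triangle x (Finset.mem_range.1 hx) p hp _ (Nat.mod_lt _ hn)
  refine (Finset.sum_le_sum h).trans ?_
  rw [Finset.sum_add_distrib, sum_range_add_mod hn (fun x => d p x), two_mul]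
  exact le_rfl

theorem shiftSum_nonneg {n : ℕ} (hd : IsPseudometric d n) (hn : 0 < n) (r : ℕ) :
    0 ≤ shiftSum d n r :=
  Finset.sum_nonneg fun _ hx => hd.nonneg (Finset.mem_range.1 hx) (Nat.mod_lt _ hn)

/-- The average shift sum is the average cost of a point. -/
theorem sum_shiftSum {n : ℕ} (hn : 0 < n) :
    ∑ r ∈ Finset.range n, shiftSum d n r = ∑ x ∈ Finset.range n, cost d n x := by
  unfold shiftSum
  rw [Finset.sum_comm]
  refine Finset.sum_congr rfl fun x _ => ?_
  rw [cost, ← sum_range_add_mod hn (fun y => d x y) x]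
  simp only [add_comm x]

/-- Shift sums are at most twice the optimum `o` and at least `o` on average, so that a fraction of
at least `η / 2` of them exceeds `(1 - η) * o`. -/
theorem sum_shiftSum_small_le {n : ℕ} {η o : ℝ} (hd : IsPseudometric d n) (hn : 0 < n)
    (hη : 0 < η) (hη1 : η ≤ 1) (hopt : ∃ i < n, cost d n i = o) (hlow : ∀ i < n, o ≤ cost d n i)
    {y : ℝ} (hy : 0 ≤ y) :
    ∑ r ∈ Finset.range n, (if (1 - η) * o ≤ shiftSum d n r then 0 else y) ≤
      n * ((1 - η / 2) * y) := by
  obtain ⟨p, hp, rfl⟩ := hopt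
  set o := cost d n p
  have hn' : (0 : ℝ) < n := by exact_mod_cast hn
  have ho : 0 ≤ o := hd.cost_nonneg hp
  rcases ho.eq_or_lt with ho | ho
  · rw [Finset.sum_eq_zero]
    · have : 0 ≤ 1 - η / 2 := by linarith
      positivity
    · intro r _
      rw [if_pos]
      rw [← ho, mul_zero]
      exact shiftSum_nonneg hd hn r
  have h1 : ∀ r ∈ Finset.range n, (if (1 - η) * o ≤ shiftSum d n r then 0 else y) * ((1 + η) * o) ≤
      (2 * o - shiftSum d n r) * y := fun r _ => by
    have h2 := shiftSum_le hd hn hp r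
    split_ifs with h
    · rw [zero_mul]
      exact mul_nonneg (by linarith) hy
    · rw [mul_comm]
      exact mul_le_mul_of_nonneg_right (by linarith) hy
  have h2 := Finset.sum_le_sum h1
  rw [← Finset.sum_mul, ← Finset.sum_mul, Finset.sum_sub_distrib, sum_shiftSum hn] at h2
  have h3 : (n : ℝ) * o ≤ ∑ x ∈ Finset.range n, cost d n x := by
    calc (n : ℝ) * o = ∑ x ∈ Finset.range n, o := by simp
      _ ≤ _ := Finset.sum_le_sum fun x hx => hlow x (Finset.mem_range.1 hx)
  simp only [Finset.sum_const, Finset.card_range, nsmul_eq_mul] at h2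
  set B := ∑ r ∈ Finset.range n, (if (1 - η) * o ≤ shiftSum d n r then 0 else y)
  have h4 : B * (1 + η) * o ≤ n * y * o := by nlinarith
  have h5 : B * (1 + η) ≤ n * y := le_of_mul_le_mul_right h4 ho
  have h6 : n * y * 1 ≤ n * y * ((1 - η / 2) * (1 + η)) := by
    apply mul_le_mul_of_nonneg_left _ (by positivity)
    nlinarith
  refine le_of_mul_le_mul_right (a := 1 + η) ?_ (by linarith)
  linarith

/-- Try random shifts until `M` of them have been tried, keeping the largest shift sum in real
variable 2. -/
def shiftLoop (M : ℕ) : Prog :=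
  .loop (.natLT (.var 4) (.lit M))
    (.seq (.rand 5 (.lit 0) (.sub (.var 0) (.lit 1))) (.seq shiftProg
      (.seq (.ite (.realLT (.var 2) (.var 0)) (.setReal 2 (.lit 0) (.var 0)) .skip)
        (.setNat 4 (.lit 0) (.add (.var 4) (.lit 1))))))

theorem wp_shiftLoop {s₀ : Store} {n M : ℕ} {η o : ℝ} (hd : IsPseudometric d n) (hn : 0 < n)
    (hn₀ : s₀.nat 0 0 = n) (hη : 0 < η) (hη1 : η ≤ 1) (hopt : ∃ i < n, cost d n i = o)
    (hlow : ∀ i < n, o ≤ cost d n i) (j : ℕ) (s : Store) (t : ℕ)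
    (hs : Unchanged (shiftLoop M) s₀ s) (hj : s.nat 4 0 + j = M) (h2 : s.real 2 0 ≤ 2 * o) :
    WP d (shiftLoop M) s t (fun x t' => (x.real 2 0 ≤ 2 * o ∧ t' ≤ t + (50 * n + 60) * j + 5) ∧
        Unchanged (shiftLoop M) s₀ x)
      (fun x _ => if (1 - η) * o ≤ x.real 2 0 then 0 else 1)
      (ENNReal.ofReal (if (1 - η) * o ≤ s.real 2 0 then 0 else (1 - η / 2) ^ j)) := by
  have hη2 : 0 ≤ 1 - η / 2 := by linarith
  induction j generalizing s t with
  | zero =>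
    refine WP.loop_exit ?_ ⟨⟨h2, ?_⟩, hs⟩ ?_
    · simp only [BExpr.Holds, NExpr.eval]
      omega
    · simp [BExpr.cost, NExpr.cost]
    · split_ifs <;> simp
  | succ j ih =>
    have hlt : BExpr.Holds d s (.natLT (.var 4) (.lit M)) := by
      simp only [BExpr.Holds, NExpr.eval]
      omega
    have h0 : s.nat 0 0 = n := by rw [hs.nat 0 rfl, hn₀]
    have hev : (NExpr.sub (.var 0) (.lit 1)).eval s + 1 = n := by
      simp only [NExpr.eval, h0]
      omega
    refine WP.loop_step (g := fun x _ =>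
      ENNReal.ofReal (if (1 - η) * o ≤ x.real 2 0 then 0 else (1 - η / 2) ^ j)) hlt
      (WP.seq_rand (fun v => ENNReal.ofReal (if (1 - η) * o ≤ max (s.real 2 0) (shiftSum d n v)
        then 0 else (1 - η / 2) ^ j)) ?_ ?_)
    · intro v hv
      have hvn : v < n := by omega
      set s₁ := s.setNat 5 ((NExpr.lit 0).eval s) v with hs₁
      refine WP.seq_const (wp_shiftProg (n := n) (r := v) (by simp [hs₁, Store.setNat, h0])
        (by simp [hs₁, Store.setNat, NExpr.eval]) hvn _) ?_
      rintro x t' ⟨⟨g1, g2⟩, g3⟩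
      have hx2 : x.real 2 0 = s.real 2 0 := by rw [g3.real 2 rfl]; rfl
      have hx4 : x.nat 4 0 = s.nat 4 0 := by rw [g3.nat 4 rfl]; simp [hs₁, Store.setNat]
      have hxs : Unchanged (shiftLoop M) s₀ x := (hs.setNat rfl _ _).trans
        (g3.of_imp (by simp +contextual [shiftLoop, Prog.setsNat])
          (by simp +contextual [shiftLoop, Prog.setsReal]))
      refine WP.seq_const (A' := fun y t'' => (y.real 2 0 = max (s.real 2 0) (shiftSum d n v) ∧
        y.nat 4 0 = s.nat 4 0 ∧ Unchanged (shiftLoop M) s₀ y) ∧ t'' ≤ t' + 20) (f' := 0) (b' := 0)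
        (WP.ite (fun h => WP.setReal ⟨⟨?_, hx4, hxs.setReal rfl _ _⟩, ?_⟩ (by simp))
          (fun h => WP.skip ⟨⟨?_, hx4, hxs⟩, ?_⟩ (by simp))) ?_
      · simp only [BExpr.Holds, RExpr.eval, NExpr.eval, g1, hx2] at h
        simp [Store.setReal, NExpr.eval, RExpr.eval, g1, h.le]
      · simp [BExpr.cost, NExpr.cost, RExpr.cost]
      · simp only [BExpr.Holds, RExpr.eval, NExpr.eval, g1, hx2, not_lt] at h
        simp [hx2, h]
      · simp [BExpr.cost, NExpr.cost, RExpr.cost]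
      rintro y t'' ⟨⟨e1, e2, e3⟩, e4⟩
      have hyb : y.real 2 0 ≤ 2 * o := by
        rw [e1]
        refine max_le h2 ?_
        obtain ⟨p, hp, rfl⟩ := hopt
        exact shiftSum_le hd hn hp v
      refine WP.setNat ?_ ?_
      · refine (ih _ _ (e3.setNat rfl _ _) ?_ hyb).mono ?_ (fun _ _ _ => le_rfl) le_rfl
        · simp [Store.setNat, NExpr.eval, e2]
          omega
        · rintro z u ⟨⟨f1, f2⟩, f3⟩
          refine ⟨⟨f1, f2.trans ?_⟩, f3⟩
          simp [BExpr.cost, NExpr.cost] at g2 ⊢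
          nlinarith
      · rw [← e1]
        exact le_rfl
    · rw [hev]
      split_ifs with hdone
      · refine sum_ofReal_div_le hn (fun v _ => ?_) ?_
        · split_ifs
          · exact le_rfl
          · positivity
        · rw [mul_zero, Finset.sum_eq_zero]
          intro v _
          rw [if_pos (hdone.trans (le_max_left _ _))]
      · refine sum_ofReal_div_le hn (fun v _ => ?_) ?_
        · split_ifs
          · exact le_rfl
          · positivity
        · rw [pow_succ, mul_comm _ (1 - η / 2)]
          refine le_trans (le_of_eq ?_) (sum_shiftSum_small_le hd hn hη hη1 hopt hlow (by positivity))
          refine Finset.sum_congr rfl fun v _ => ?_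
          simp [hdone]

/-! ### Repeating until the certificate is found -/

/-- One repetition: offer the winner of a tournament and the point whose number is kept in variable 2
as best points, and improve the lower bound by random shifts.  The number of samples makes the
tournament fail with probability at most `1 / 4` at accuracy `1 / (4 * K)`, and so does the number
of shifts, each of which succeeds with probability at least `1 / (8 * K)`. -/
def round (K : ℕ) : Prog :=
  .seq (tournament (524288 * (K * K))) (.seq (update (.get 6 (.lit 0))) (.seq (update (.var 2))
    (.seq (.setNat 4 (.lit 0) (.lit 0)) (.seq (shiftLoop (24 * K))
      (.setNat 2 (.lit 0) (.add (.var 2) (.lit 1)))))))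

/-- No certificate yet: fewer than `n` rounds have been played, and `K` times the best cost exceeds
`K + 1` times the largest shift sum. -/
def guard (K : ℕ) : BExpr :=
  .and (.natLT (.var 2) (.var 0))
    (.realLT (.mul (.ofNat (.lit (K + 1))) (.var 2)) (.mul (.ofNat (.lit K)) (.var 1)))

/-- The algorithm: start from point 0, and play rounds while there is no certificate. -/
def medianProg (K : ℕ) : Prog :=
  .seq (costProg (.lit 0)) (.seq (.setReal 1 (.lit 0) (.var 0)) (.loop (guard K) (round K)))

/-- What holds between rounds: real variable 1 is the cost of the point kept in variable 1, it is
at most the cost of the points tried systematically, and real variable 2 is at most twice the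
optimum `o`. -/
structure RoundInv (d : ℕ → ℕ → ℝ) (n : ℕ) (o : ℝ) (s : Store) : Prop where
  size : s.nat 0 0 = n
  best_lt : s.nat 1 0 < n
  best_cost : s.real 1 0 = cost d n (s.nat 1 0)
  best_le : ∀ y < s.nat 2 0, y < n → s.real 1 0 ≤ cost d n y
  bound : s.real 2 0 ≤ 2 * o

/-- A bound for the running time of a round.  Its leading term comes from the tournament, whose
first round uses `524288 * K ^ 2` samples per duel. -/
def roundTime (n K : ℕ) : ℕ := 262200000 * (n * (K * K))

open Classical in
theorem wp_round {n K : ℕ} {o : ℝ} (hd : IsPseudometric d n) (hn : 0 < n) (hK : 0 < K)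
    (hopt : ∃ i < n, cost d n i = o) (hlow : ∀ i < n, o ≤ cost d n i) {s : Store}
    (hs : RoundInv d n o s) (hlt : s.nat 2 0 < n) (t : ℕ) :
    WP d (round K) s t (fun x t' => RoundInv d n o x ∧ x.nat 2 0 = s.nat 2 0 + 1 ∧
        t' ≤ t + roundTime n K)
      (fun x _ => if x.real 1 0 ≤ (1 + 1 / (4 * K)) * o ∧ (1 - 1 / (4 * K)) * o ≤ x.real 2 0
        then 0 else 1) (1 / 2) := by
  have hK' : (1 : ℝ) ≤ K := by exact_mod_cast hK
  set η : ℝ := 1 / (4 * K) with hη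
  have hη0 : 0 < η := by positivity
  have hη1 : η ≤ 1 / 4 := by
    rw [hη, div_le_div_iff₀ (by positivity) (by norm_num)]
    linarith
  have hηK : 4 * (K * η) = 1 := by
    rw [hη]
    field_simp
  have ho : 0 ≤ o := by
    obtain ⟨p, hp, rfl⟩ := hopt
    exact hd.cost_nonneg hp
  have hkη : (32768 : ℝ) ≤ (524288 * (K * K) : ℕ) * η ^ 2 := by
    push_cast
    have : (524288 : ℝ) * (K * K) * η ^ 2 = 32768 * (4 * (K * η)) ^ 2 := by ring
    rw [this, hηK]
    norm_num
  have htour := (wp_tournament (k₀ := 524288 * (K * K)) (η := η) (o := o) hd hn hs.size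
    (by have := Nat.mul_pos hK hK; omega) hη0 (by linarith) ho
    (hopt.imp fun i hi => ⟨hi.1, hi.2.le⟩) hkη t).add_const (1 / 4)
  refine WP.seq (htour.mono ?_ (fun _ _ _ => le_rfl) ?_)
  swap
  · rw [ENNReal.div_add_div_same, one_add_one_eq_two]
    refine ENNReal.div_le_of_le_mul (le_of_eq ?_)
    rw [show (4 : ℝ≥0∞) = 2 * 2 by norm_num, ← mul_assoc, one_div,
      ENNReal.inv_mul_cancel (by simp) (by simp), one_mul]
  rintro x t₁ ⟨⟨hx6, ht₁⟩, hx⟩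
  have x0 : x.nat 0 0 = n := by rw [hx.nat 0 rfl, hs.size]
  have x1 : x.nat 1 0 = s.nat 1 0 := by rw [hx.nat 1 rfl]
  have x2 : x.nat 2 0 = s.nat 2 0 := by rw [hx.nat 2 rfl]
  have xr1 : x.real 1 0 = s.real 1 0 := by rw [hx.real 1 rfl]
  have xr2 : x.real 2 0 = s.real 2 0 := by rw [hx.real 2 rfl]
  refine WP.seq_const (wp_update (n := n) (p := x.nat 6 0) x0 (by simp [NExpr.cost])
    (fun s' hs' => by simp only [NExpr.eval]; rw [hs'.nat 6 rfl]) t₁) ?_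
  rintro y t₂ ⟨⟨⟨hymin, hyb⟩, ht₂⟩, hy⟩
  have y0 : y.nat 0 0 = n := by rw [hy.nat 0 rfl, x0]
  have y2 : y.nat 2 0 = s.nat 2 0 := by rw [hy.nat 2 rfl, x2]
  have yr2 : y.real 2 0 = s.real 2 0 := by rw [hy.real 2 rfl, xr2]
  have hyv : y.nat 1 0 < n ∧ y.real 1 0 = cost d n (y.nat 1 0) := by
    rcases hyb with ⟨e1, e2⟩ | ⟨e1, e2⟩
    · rw [e1, e2]
      exact ⟨hx6, rfl⟩
    · rw [e1, e2, x1, xr1]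
      exact ⟨hs.best_lt, hs.best_cost⟩
  refine WP.seq_const (wp_update (n := n) (p := s.nat 2 0) y0 (by simp [NExpr.cost])
    (fun s' hs' => by simp only [NExpr.eval]; rw [hs'.nat 2 rfl, y2]) t₂) ?_
  rintro z t₃ ⟨⟨⟨hzmin, hzb⟩, ht₃⟩, hz⟩
  have z0 : z.nat 0 0 = n := by rw [hz.nat 0 rfl, y0]
  have z2 : z.nat 2 0 = s.nat 2 0 := by rw [hz.nat 2 rfl, y2]
  have zr2 : z.real 2 0 = s.real 2 0 := by rw [hz.real 2 rfl, yr2]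
  have hzv : z.nat 1 0 < n ∧ z.real 1 0 = cost d n (z.nat 1 0) := by
    rcases hzb with ⟨e1, e2⟩ | ⟨e1, e2⟩
    · rw [e1, e2]
      exact ⟨hlt, rfl⟩
    · rw [e1, e2]
      exact hyv
  have hz1 : z.real 1 0 = min (min (s.real 1 0) (cost d n (x.nat 6 0))) (cost d n (s.nat 2 0)) := by
    rw [hzmin, hymin, xr1]
  set z' := z.setNat 4 ((NExpr.lit 0).eval z) ((NExpr.lit 0).eval z) with hz'
  have z'n : ∀ a ≠ 4, z'.nat a = z.nat a := fun a ha => by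
    funext i
    simp [hz', Store.setNat, ha]
  have z'4 : z'.nat 4 0 = 0 := by simp [hz', Store.setNat, NExpr.eval]
  have z'r : z'.real = z.real := rfl
  refine WP.seq_setNat ?_
  have hshift := wp_shiftLoop (M := 24 * K) (s₀ := z') hd hn (by rw [z'n 0 (by decide), z0]) hη0
    (by linarith) hopt hlow (24 * K) z' (t₃ + ((NExpr.lit 0).cost + (NExpr.lit 0).cost + 1))
    (.refl _ _) (by rw [z'4, zero_add]) (by rw [z'r, zr2]; exact hs.bound)
  -- what remains to be done after the shifts
  have hlast : ∀ w t₄, ((w.real 2 0 ≤ 2 * o ∧ t₄ ≤ (t₃ + ((NExpr.lit 0).cost + (NExpr.lit 0).cost +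
        1)) + (50 * n + 60) * (24 * K) + 5) ∧ Unchanged (shiftLoop (24 * K)) z' w) →
      w.real 1 0 = z.real 1 0 ∧
      WP d (.setNat 2 (.lit 0) (.add (.var 2) (.lit 1))) w t₄
        (fun x t' => RoundInv d n o x ∧ x.nat 2 0 = s.nat 2 0 + 1 ∧ t' ≤ t + roundTime n K)
        (fun x _ => if x.real 1 0 ≤ (1 + η) * o ∧ (1 - η) * o ≤ x.real 2 0 then 0 else 1)
        (if w.real 1 0 ≤ (1 + η) * o ∧ (1 - η) * o ≤ w.real 2 0 then 0 else 1) := by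
    rintro w t₄ ⟨⟨hw2, ht₄⟩, hw⟩
    have w1 : w.real 1 0 = z.real 1 0 := by rw [hw.real 1 rfl, z'r]
    have wn1 : w.nat 1 0 = z.nat 1 0 := by rw [hw.nat 1 rfl, z'n 1 (by decide)]
    have wn2 : w.nat 2 0 = s.nat 2 0 := by rw [hw.nat 2 rfl, z'n 2 (by decide), z2]
    have wn0 : w.nat 0 0 = n := by rw [hw.nat 0 rfl, z'n 0 (by decide), z0]
    refine ⟨w1, WP.setNat ⟨⟨?_, ?_, ?_, ?_, ?_⟩, ?_, ?_⟩ le_rfl⟩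
    · simpa [Store.setNat] using wn0
    · simpa [Store.setNat, wn1] using hzv.1
    · simpa [Store.setNat, wn1, w1] using hzv.2
    · intro v hv hvn
      have hv' : v < s.nat 2 0 + 1 := by simpa [Store.setNat, NExpr.eval, wn2] using hv
      have : w.real 1 0 ≤ cost d n v := by
        rw [w1, hz1]
        rcases Nat.lt_succ_iff_lt_or_eq.1 hv' with h | rfl
        · exact (min_le_left _ _).trans ((min_le_left _ _).trans (hs.best_le v h hvn))
        · exact min_le_right _ _
      simpa [Store.setNat] using this
    · simpa [Store.setNat] using hw2
    · simp [Store.setNat, NExpr.eval, wn2]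
    · simp only [NExpr.cost] at ht₄ ⊢
      have p1 : K ≤ K * K := Nat.le_mul_of_pos_left K hK
      have p2 : K * K ≤ n * (K * K) := Nat.le_mul_of_pos_left _ hn
      have p3 : n * K ≤ n * (K * K) := Nat.mul_le_mul_left n p1
      have p4 : n ≤ n * (K * K) := Nat.le_mul_of_pos_right n (Nat.mul_pos hK hK)
      have e1 : 500 * (524288 * (K * K)) * n = 262144000 * (n * (K * K)) := by ring
      have e2 : (50 * n + 60) * (24 * K) = 1200 * (n * K) + 1440 * K := by ring
      rw [e1] at ht₁
      rw [e2] at ht₄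
      unfold roundTime
      omega
  by_cases hgood : cost d n (x.nat 6 0) ≤ (1 + η) * o
  · rw [if_pos hgood, zero_add]
    have hz1' : z.real 1 0 ≤ (1 + η) * o := by
      rw [hz1]
      exact (min_le_left _ _).trans ((min_le_right _ _).trans hgood)
    refine WP.seq (g := fun w _ => if w.real 1 0 ≤ (1 + η) * o ∧ (1 - η) * o ≤ w.real 2 0
      then 0 else 1) ((hshift.unchanged).mono (fun w t₄ hw => (hlast w t₄ hw.1).2)
        (fun w t₄ hw => ?_) ?_)
    · rw [(hlast w t₄ hw.1).1]
      simp only [hz1', true_and]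
      exact le_rfl
    · refine (ENNReal.ofReal_le_ofReal (q := 1 / 4) ?_).trans (le_of_eq ?_)
      · -- Bernoulli: `(1 - a) ^ M * (1 + M * a) ≤ ((1 - a) * (1 + a)) ^ M ≤ 1`, where `M * a = 3`
        have ha : 0 ≤ 1 - η / 2 := by linarith
        have hb : 1 + ((24 * K : ℕ) : ℝ) * (η / 2) ≤ (1 + η / 2) ^ (24 * K) :=
          one_add_mul_le_pow (by linarith) _
        have hb4 : (4 : ℝ) ≤ (1 + η / 2) ^ (24 * K) := by
          refine le_trans (le_of_eq ?_) hb
          push_cast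
          linarith
        have hc : (1 - η / 2) ^ (24 * K) * (1 + η / 2) ^ (24 * K) ≤ 1 := by
          rw [← mul_pow]
          exact pow_le_one₀ (mul_nonneg ha (by linarith)) (by nlinarith)
        have hp : 0 ≤ (1 - η / 2) ^ (24 * K) := pow_nonneg ha _
        split_ifs
        · norm_num
        · nlinarith
      · rw [ENNReal.ofReal_div_of_pos (by norm_num)]
        simp
  · rw [if_neg hgood]
    refine WP.seq (g := fun w _ => if w.real 1 0 ≤ (1 + η) * o ∧ (1 - η) * o ≤ w.real 2 0
      then 0 else 1) (hshift.const (fun w t₄ hw => ⟨(hlast w t₄ hw).2, ?_⟩))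
    refine le_trans ?_ le_self_add
    split_ifs <;> simp

/-- A point close to the optimum together with a large shift sum is a certificate: the slack between
`1 + 1 / K` and `1` pays for both inaccuracies `1 / (4 * K)`. -/
theorem not_guard_of_good {K : ℕ} (hK : 0 < K) {o : ℝ} (ho : 0 ≤ o) {s : Store}
    (h1 : s.real 1 0 ≤ (1 + 1 / (4 * K)) * o) (h2 : (1 - 1 / (4 * K)) * o ≤ s.real 2 0) :
    ¬ (guard K).Holds d s := by
  have hK' : (1 : ℝ) ≤ K := by exact_mod_cast hK
  rintro ⟨-, h⟩
  simp only [BExpr.Holds, RExpr.eval, NExpr.eval] at h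
  push_cast at h
  set η : ℝ := 1 / (4 * K) with hη
  have hηK : K * η = 1 / 4 := by
    rw [hη]
    field_simp
  have hη1 : η ≤ 1 / 4 := by
    rw [hη, div_le_div_iff₀ (by positivity) (by norm_num)]
    linarith
  have h3 := mul_le_mul_of_nonneg_left h1 (show (0 : ℝ) ≤ K by linarith)
  have h4 := mul_le_mul_of_nonneg_left h2 (show (0 : ℝ) ≤ K + 1 by linarith)
  have e3 : K * ((1 + η) * o) = K * o + 1 / 4 * o := by
    rw [← hηK]; ring
  have e4 : ((K : ℝ) + 1) * ((1 - η) * o) = K * o + 3 / 4 * o - η * o + (1 / 4 - K * η) * o := by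
    ring
  rw [hηK, sub_self, zero_mul, add_zero] at e4
  have := mul_le_mul_of_nonneg_right hη1 ho
  nlinarith

/-- The cost of evaluating the guard and branching on it. -/
theorem guard_cost (K : ℕ) : (guard K).cost + 1 = 18 := by
  simp [guard, BExpr.cost, RExpr.cost, NExpr.cost]

open Classical in
/-- Each round fails with probability at most `1 / 2`, so the expected remaining time is at most
twice that of a round. -/
theorem wp_loop_expectedTime {n K : ℕ} {o : ℝ} (hd : IsPseudometric d n) (hn : 0 < n) (hK : 0 < K)
    (hopt : ∃ i < n, cost d n i = o) (hlow : ∀ i < n, o ≤ cost d n i) (k : ℕ) (s : Store)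
    (hs : RoundInv d n o s) (hk : s.nat 2 0 + k = n) (t : ℕ) :
    WP d (.loop (guard K) (round K)) s t
      (fun x _ => RoundInv d n o x ∧ ¬ (guard K).Holds d x) (fun _ t' => (t' : ℝ≥0∞))
      (t + 18 + if (guard K).Holds d s then ((2 * (roundTime n K + 18) : ℕ) : ℝ≥0∞) else 0) := by
  have ho : 0 ≤ o := by
    obtain ⟨p, hp, rfl⟩ := hopt
    exact hd.cost_nonneg hp
  induction k generalizing s t with
  | zero =>
    have hg : ¬ (guard K).Holds d s := by
      rintro ⟨h, -⟩
      simp only [BExpr.Holds, NExpr.eval, hs.size] at h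
      omega
    refine WP.loop_exit hg ⟨hs, hg⟩ ?_
    rw [guard_cost, if_neg hg]
    push_cast
    simp
  | succ k ih =>
    by_cases hg : (guard K).Holds d s
    swap
    · refine WP.loop_exit hg ⟨hs, hg⟩ ?_
      rw [guard_cost, if_neg hg]
      push_cast
      simp
    rw [if_pos hg]
    refine WP.loop_step hg ?_ (g := fun x t' => (t' : ℝ≥0∞) + 18 +
      if (guard K).Holds d x then ((2 * (roundTime n K + 18) : ℕ) : ℝ≥0∞) else 0)
    rw [guard_cost]
    have hr := ((wp_round hd hn hK hopt hlow hs (by omega) (t + 18)).const_mul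
      ((2 * (roundTime n K + 18) : ℕ) : ℝ≥0∞)).add_const ((t + 18 + roundTime n K + 18 : ℕ) : ℝ≥0∞)
    refine hr.mono (fun x t' hx => ih x hx.1 (by omega) t') (fun x t' hx => ?_) ?_
    · have h1 : (t' : ℝ≥0∞) + 18 ≤ ((t + 18 + roundTime n K + 18 : ℕ) : ℝ≥0∞) := by
        exact_mod_cast (show t' + 18 ≤ t + 18 + roundTime n K + 18 by omega)
      rw [add_comm]
      refine add_le_add ?_ h1
      by_cases hgood : x.real 1 0 ≤ (1 + 1 / (4 * K)) * o ∧ (1 - 1 / (4 * K)) * o ≤ x.real 2 0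
      · rw [if_neg (not_guard_of_good hK ho hgood.1 hgood.2)]
        exact zero_le
      · rw [if_neg hgood, mul_one]
        split_ifs
        · exact le_rfl
        · exact zero_le
    · have h2 : ((2 * (roundTime n K + 18) : ℕ) : ℝ≥0∞) * (1 / 2) =
          ((roundTime n K + 18 : ℕ) : ℝ≥0∞) := by
        rw [Nat.cast_mul, mul_comm, ← mul_assoc, Nat.cast_ofNat, one_div,
          ENNReal.inv_mul_cancel (by simp) (by simp), one_mul]
      rw [h2]
      norm_cast
      omega

open Classical in
/-- The first round succeeds with probability at least `1 / 2`, and then the loop ends. -/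
theorem wp_loop_first {n K : ℕ} {o : ℝ} (hd : IsPseudometric d n) (hn : 0 < n) (hK : 0 < K)
    (hopt : ∃ i < n, cost d n i = o) (hlow : ∀ i < n, o ≤ cost d n i) (s : Store)
    (hs : RoundInv d n o s) (h2 : s.nat 2 0 = 0) (hr2 : s.real 2 0 = 0) (t : ℕ) :
    WP d (.loop (guard K) (round K)) s t (fun _ _ => True)
      (fun x t' => if x.real 1 0 ≤ (1 + 1 / (4 * K)) * o ∧ t' ≤ t + roundTime n K + 36
        then 0 else 1) (1 / 2) := by
  have hK' : (1 : ℝ) ≤ K := by exact_mod_cast hK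
  have ho : 0 ≤ o := by
    obtain ⟨p, hp, rfl⟩ := hopt
    exact hd.cost_nonneg hp
  by_cases hg : (guard K).Holds d s
  · refine WP.loop_step (g := fun x _ => if x.real 1 0 ≤ (1 + 1 / (4 * K)) * o ∧
      (1 - 1 / (4 * K)) * o ≤ x.real 2 0 then 0 else 1) hg ?_
    rw [guard_cost]
    refine (wp_round hd hn hK hopt hlow hs (by omega) (t + 18)).mono (fun x t' hx => ?_)
      (fun _ _ _ => le_rfl) le_rfl
    split_ifs with hgood
    · refine WP.loop_exit (not_guard_of_good hK ho hgood.1 hgood.2) trivial ?_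
      rw [guard_cost, if_pos ⟨hgood.1, by omega⟩]
    · refine (wp_loop_expectedTime hd hn hK hopt hlow (n - x.nat 2 0) x hx.1 (by omega) t').const
        fun y t'' _ => ⟨trivial, ?_⟩
      split_ifs <;> simp
  · refine WP.loop_exit hg trivial ?_
    rw [guard_cost, if_pos]
    · exact zero_le
    · refine ⟨?_, by omega⟩
      -- with no shift tried yet, the certificate can only say that the best cost is zero
      have h3 : (K : ℝ) * s.real 1 0 ≤ 0 := by
        by_contra hcon
        refine hg ⟨?_, ?_⟩
        · simp only [BExpr.Holds, NExpr.eval, hs.size]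
          omega
        · simp only [BExpr.Holds, RExpr.eval, NExpr.eval, hr2]
          linarith
      have h4 : s.real 1 0 ≤ 0 := by
        by_contra hcon
        nlinarith
      have : 0 ≤ (1 + 1 / (4 * (K : ℝ))) * o := by positivity
      linarith

theorem wp_medianProg {n K : ℕ} {o : ℝ} (hn : 0 < n) (ho : 0 ≤ o) {A : Store → ℕ → Prop} {f : Store → ℕ → ℝ≥0∞}
    {b : ℝ≥0∞}
    (h : ∀ s t, RoundInv d n o s → s.nat 2 0 = 0 → s.real 2 0 = 0 → t ≤ 22 * n + 20 →
      WP d (.loop (guard K) (round K)) s t A f b) :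
    WP d (medianProg K) (initial n) 0 A f b := by
  refine WP.seq_const (wp_costProg (n := n) (p := 0) (by simp [initial]) (by simp [NExpr.cost])
    (fun _ _ => rfl) 0) ?_
  rintro x t ⟨⟨h1, h2⟩, h3⟩
  have x0 : x.nat 0 0 = n := by rw [h3.nat 0 rfl]; simp [initial]
  have x1 : x.nat 1 0 = 0 := by rw [h3.nat 1 rfl]; simp [initial]
  have x2 : x.nat 2 0 = 0 := by rw [h3.nat 2 rfl]; simp [initial]
  have xr2 : x.real 2 0 = 0 := by rw [h3.real 2 rfl]; simp [initial]
  refine WP.seq_setReal (h _ _ ⟨?_, ?_, ?_, ?_, ?_⟩ ?_ ?_ ?_)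
  · simpa [Store.setReal] using x0
  · simpa [Store.setReal, x1] using hn
  · simp [Store.setReal, RExpr.eval, NExpr.eval, h1, x1]
  · intro y hy
    simp [Store.setReal, x2] at hy
  · simpa [Store.setReal, xr2] using ho
  · simpa [Store.setReal] using x2
  · simpa [Store.setReal] using xr2
  · simp [RExpr.cost, NExpr.cost] at h2 ⊢
    omega

/-- When the loop ends, either a shift sum certifies the best point, or all points have been
tried. -/
theorem RoundInv.cost_le {n K : ℕ} {o : ℝ} (hK : 0 < K) (ho : 0 ≤ o)
    (hopt : ∃ i < n, cost d n i = o) {s : Store} (hs : RoundInv d n o s)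
    (hg : ¬ (guard K).Holds d s) : s.real 1 0 ≤ (2 + 2 / K) * o := by
  have hK' : (1 : ℝ) ≤ K := by exact_mod_cast hK
  by_cases hlt : s.nat 2 0 < n
  · have h : (K : ℝ) * s.real 1 0 ≤ (K + 1) * s.real 2 0 := by
      by_contra hcon
      refine hg ⟨?_, ?_⟩
      · simpa only [BExpr.Holds, NExpr.eval, hs.size] using hlt
      · simp only [BExpr.Holds, RExpr.eval, NExpr.eval]
        push_cast
        linarith
    have h1 := mul_le_mul_of_nonneg_left hs.bound (show (0 : ℝ) ≤ K + 1 by linarith)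
    refine le_of_mul_le_mul_left ?_ (show (0 : ℝ) < K by linarith)
    have : (K : ℝ) * ((2 + 2 / K) * o) = (K + 1) * (2 * o) := by
      field_simp
    linarith
  · obtain ⟨p, hp, rfl⟩ := hopt
    have := hs.best_le p (by omega) hp
    have h2 : 0 ≤ 2 / (K : ℝ) := by positivity
    nlinarith

end OracleRAM

/-! ### The oracle of a finite metric space -/

open OracleRAM in
theorem isPseudometric_distOracle {n : ℕ} (M : MetricSpace (Fin n)) :
    IsPseudometric (distOracle M) n where
  self i hi := by
    rw [distOracle, dif_pos ⟨hi, hi⟩]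
    exact M.dist_self _
  symm i hi j hj := by
    rw [distOracle, distOracle, dif_pos ⟨hi, hj⟩, dif_pos ⟨hj, hi⟩]
    exact M.dist_comm _ _
  triangle i hi j hj k hk := by
    simp only [distOracle, dif_pos (And.intro hi hj), dif_pos (And.intro hi hk),
      dif_pos (And.intro hj hk)]
    exact M.dist_triangle _ _ _

theorem cost_distOracle {n : ℕ} (M : MetricSpace (Fin n)) {i : ℕ} (hi : i < n) :
    OracleRAM.cost (distOracle M) n i = ∑ x, M.dist ⟨i, hi⟩ x := by
  unfold OracleRAM.cost
  rw [Finset.sum_range]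
  refine Finset.sum_congr rfl fun x _ => ?_
  rw [distOracle, dif_pos ⟨hi, x.2⟩]

/-- Every metric on `{0, …, n - 1}` has a point that attains the optimal cost. -/
theorem exists_cost_eq_iInf {n : ℕ} (hn : 0 < n) (M : MetricSpace (Fin n)) :
    (∃ i < n, OracleRAM.cost (distOracle M) n i = ⨅ y : Fin n, ∑ x, M.dist y x) ∧
      ∀ i < n, ⨅ y : Fin n, ∑ x, M.dist y x ≤ OracleRAM.cost (distOracle M) n i := by
  have : Nonempty (Fin n) := ⟨⟨0, hn⟩⟩
  constructor
  · obtain ⟨y, hy⟩ := exists_eq_ciInf_of_finite (f := fun y : Fin n => ∑ x, M.dist y x)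
    exact ⟨y, y.2, by rw [cost_distOracle M y.2]; exact hy⟩
  · intro i hi
    rw [cost_distOracle M hi]
    exact ciInf_le (Set.finite_range _).bddBelow (⟨i, hi⟩ : Fin n)

theorem PMF.le_toOuterMeasure_of_tsum_le {α : Type*} (μ : PMF α) (S : Set α) [DecidablePred (· ∈ S)]
    (h : ∑' x, μ x * (if x ∈ S then 0 else 1) ≤ 1 / 2) : 1 / 2 ≤ μ.toOuterMeasure S := by
  rw [PMF.toOuterMeasure_apply]
  have h1 : ∑' x, μ x * (if x ∈ S then 0 else 1) + ∑' x, S.indicator μ x = 1 := by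
    rw [← ENNReal.tsum_add, ← μ.tsum_coe]
    refine tsum_congr fun x => ?_
    by_cases hx : x ∈ S <;> simp [hx]
  by_contra hcon
  have h2 := ENNReal.add_lt_add_of_le_of_lt (ne_top_of_le_ne_top (by simp) h) h (not_le.1 hcon)
  rw [h1, ENNReal.add_halves] at h2
  exact lt_irrefl _ h2

theorem theorem1 :
    ∃ C c : ℝ, 0 < C ∧ 0 < c ∧ ∀ ε : ℝ, 0 < ε →
      ∃ (P : OracleRAM.Prog) (N : ℕ), ∀ n : ℕ, 1 ≤ n → ∀ M : MetricSpace (Fin n),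
        ∃ μ : PMF (OracleRAM.Store × ℕ),
          OracleRAM.Runs (distOracle M) P (OracleRAM.initial n) μ ∧
          (∀ x ∈ μ.support, IsApproxMedian M (2 + ε) (OracleRAM.output x.1)) ∧
          (N ≤ n →
            expectedTime μ ≤ ENNReal.ofReal (C * n / (min ε 1) ^ 2) ∧
            ENNReal.ofReal c ≤ μ.toOuterMeasure
              {x | IsApproxMedian M (1 + ε) (OracleRAM.output x.1) ∧
                (x.2 : ℝ) ≤ C * n / (min ε 1) ^ 2}) := by
  classical
  refine ⟨9 * 600000000, 1 / 2, by norm_num, by norm_num, fun ε hε => ?_⟩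
  set δ := min ε 1 with hδ
  have hδ0 : 0 < δ := lt_min hε one_pos
  have hδ1 : δ ≤ 1 := min_le_right _ _
  have hδε : δ ≤ ε := min_le_left _ _
  set K := ⌈2 / δ⌉₊ with hK
  have hK2 : 2 / δ ≤ K := Nat.le_ceil _
  have hK3 : (K : ℝ) ≤ 3 / δ := by
    have h1 : (K : ℝ) < 2 / δ + 1 := Nat.ceil_lt_add_one (by positivity)
    have h2 : 1 ≤ 1 / δ := by rw [le_div_iff₀ hδ0]; linarith
    have h3 : 3 / δ = 2 / δ + 1 / δ := by ring
    linarith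
  have hK0 : 0 < K := Nat.ceil_pos.2 (by positivity)
  have hKr : (0 : ℝ) < K := by exact_mod_cast hK0
  have hKδ : 2 / (K : ℝ) ≤ δ := by
    rw [div_le_iff₀ hKr, mul_comm]
    exact (div_le_iff₀ hδ0).1 hK2
  refine ⟨OracleRAM.medianProg K, 0, fun n hn M => ?_⟩
  have hd := isPseudometric_distOracle M
  obtain ⟨hopt, hlow⟩ := exists_cost_eq_iInf hn M
  set o := ⨅ y : Fin n, ∑ x, M.dist y x with ho'
  have ho : 0 ≤ o := by
    obtain ⟨p, hp, hpo⟩ := hopt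
    rw [← hpo]
    exact hd.cost_nonneg hp
  have happrox : ∀ {s : OracleRAM.Store} {α β : ℝ}, OracleRAM.RoundInv (distOracle M) n o s →
      s.real 1 0 ≤ β * o → β ≤ α → IsApproxMedian M α (OracleRAM.output s) := by
    intro s α β hs h1 h2
    have hb : OracleRAM.output s < n := hs.best_lt
    have hc : OracleRAM.cost (distOracle M) n (OracleRAM.output s) = s.real 1 0 :=
      hs.best_cost.symm
    refine ⟨hb, ?_⟩
    rw [← cost_distOracle M hb, hc]
    exact h1.trans (mul_le_mul_of_nonneg_right h2 ho)
  obtain ⟨μ, hμ, hA, hE⟩ := OracleRAM.wp_medianProg (K := K) hn ho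
    (A := fun x _ => OracleRAM.RoundInv (distOracle M) n o x ∧
      ¬ (OracleRAM.guard K).Holds (distOracle M) x) (f := fun _ t' => (t' : ℝ≥0∞))
    (b := ((22 * n + 20 + 18 + 2 * (OracleRAM.roundTime n K + 18) : ℕ) : ℝ≥0∞))
    (fun s t hs h2 _ ht => (OracleRAM.wp_loop_expectedTime hd hn hK0 hopt hlow n s hs
      (by omega) t).mono (fun _ _ h => h) (fun _ _ _ => le_rfl) (by
        have h1 : (t : ℝ≥0∞) ≤ ((22 * n + 20 : ℕ) : ℝ≥0∞) := by exact_mod_cast ht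
        push_cast at h1 ⊢
        gcongr
        split_ifs
        · exact le_rfl
        · exact zero_le))
  obtain ⟨ν, hν, -, hF⟩ := OracleRAM.wp_medianProg (K := K) hn ho (A := fun _ _ => True)
    (f := fun x t' => if x.real 1 0 ≤ (1 + 1 / (4 * K)) * o ∧
      t' ≤ 22 * n + 20 + OracleRAM.roundTime n K + 36 then 0 else 1) (b := 1 / 2)
    (fun s t hs h2 hr2 ht => (OracleRAM.wp_loop_first hd hn hK0 hopt hlow s hs h2 hr2 t).mono
      (fun _ _ h => h) (fun x t' _ => by
        by_cases h : x.real 1 0 ≤ (1 + 1 / (4 * K)) * o ∧ t' ≤ t + OracleRAM.roundTime n K + 36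
        · rw [if_pos h, if_pos ⟨h.1, by omega⟩]
        · rw [if_neg h]
          split_ifs <;> simp) le_rfl)
  obtain rfl := hν.unique hμ
  have htime : ((22 * n + 20 + 18 + 2 * (OracleRAM.roundTime n K + 18) : ℕ) : ℝ) ≤
      9 * 600000000 * n / δ ^ 2 := by
    have h1 : 22 * n + 20 + 18 + 2 * (OracleRAM.roundTime n K + 18) ≤
        600000000 * (n * (K * K)) := by
      have : n ≤ n * (K * K) := Nat.le_mul_of_pos_right n (Nat.mul_pos hK0 hK0)
      unfold OracleRAM.roundTime
      omega
    calc ((22 * n + 20 + 18 + 2 * (OracleRAM.roundTime n K + 18) : ℕ) : ℝ)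
        ≤ ((600000000 * (n * (K * K)) : ℕ) : ℝ) := by exact_mod_cast h1
      _ = 600000000 * n * ((K : ℝ) * K) := by push_cast; ring
      _ ≤ 600000000 * n * (3 / δ * (3 / δ)) := by gcongr
      _ = 9 * 600000000 * n / δ ^ 2 := by field_simp; ring
  refine ⟨ν, hμ, fun x hx => ?_, fun _ => ⟨?_, ?_⟩⟩
  · obtain ⟨h1, h2⟩ := hA x hx
    exact happrox h1 (h1.cost_le hK0 ho hopt h2) (by linarith)
  · simp only [zero_add] at hE
    refine hE.trans ?_
    rw [← ENNReal.ofReal_natCast]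
    exact ENNReal.ofReal_le_ofReal htime
  · rw [ENNReal.ofReal_div_of_pos (by norm_num), ENNReal.ofReal_one, ENNReal.ofReal_ofNat]
    refine PMF.le_toOuterMeasure_of_tsum_le ν _ (le_trans (ENNReal.tsum_le_tsum fun x => ?_) hF)
    by_cases hx : x ∈ ν.support
    swap
    · rw [PMF.mem_support_iff, not_not] at hx
      simp [hx]
    gcongr
    simp only [zero_add]
    by_cases h : x.1.real 1 0 ≤ (1 + 1 / (4 * K)) * o ∧
        x.2 ≤ 22 * n + 20 + OracleRAM.roundTime n K + 36
    · rw [if_pos, if_pos h]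
      refine ⟨happrox (hA x hx).1 h.1 ?_, le_trans ?_ htime⟩
      · have : 1 / (4 * (K : ℝ)) ≤ 2 / K := by
          rw [div_le_div_iff₀ (by positivity) hKr]
          linarith
        linarith
      · exact_mod_cast (show x.2 ≤ 22 * n + 20 + 18 + 2 * (OracleRAM.roundTime n K + 18) by omega)
    · rw [if_neg h]
      split_ifs <;> simp
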